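/- **Setting.** Let $(\Theta,\nu)$ and $(\mathsf Z,\lambda)$ be measurable spaces with $\sigma$-finite reference measures, written $\mathrm d\theta$ and $\mathrm dz$. A state-space model is given by a prior probability density $\eta(\theta)$, an initial probability density $\mu_\theta(z)$, a transition probability density $f_\theta(z,z')$ and an observation density $g_\theta(z,y)\ge 0$, all finite and measurable. Fix $T\ge 1$ and observations $y=y_{1:T}$, write $z=z_{1:T}$, and let $$p_\theta(z,y)=\mu_\theta(z_1)\prod_{t=2}^T f_\theta(z_{t-1},z_t)\prod_{t=1}^T g_\theta(z_t,y_t).$$ The posterior $\pi(\mathrm d(\theta,z))$ has density proportional to $\eta(\theta)\,p_\theta(z,y)$ on $\Theta\times\mathsf Z^T$. Let $q(\theta,\theta')$ be a proposal probability density on $\Theta$, and let $\tilde\theta_1,\tilde\theta_2:\Theta^2\to\Theta$ be measurable with $\tilde\theta_1(\theta,\theta')=\tilde\theta_2(\theta',\theta)$. Assume that if $\eta(\theta)>0$, $q(\theta,\theta')>0$ and $p_\theta(z,y)>0$, then $p_{\tilde\theta_2(\theta,\theta')}(z,y)>0$ (this holds, for instance, if the densities $p_\theta(\cdot,y)$,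 $\theta\in\Theta$, have the same support). **Conditional SMC.** Particles are initialised from a probability density $h_\theta$ and propagated to time $t\ge2$ with a transition density $H_{\theta,t}$. The importance weights are functions $w_{\theta,t}(z)\in[0,\infty)$ of the current particle with $w_{\theta,1}(z)h_\theta(z)=\mu_\theta(z)g_\theta(z,y_1)$ and $w_{\theta,t}(z')H_{\theta,t}(z,z')=f_\theta(z,z')g_\theta(z',y_t)$ for $t\ge2$. The bootstrap particle filter $h_\theta=\mu_\theta$, $H_{\theta,t}=f_\theta$, $w_{\theta,t}(z)=g_\theta(z,y_t)$ is the main case. For $M\ge1$, $\mathrm{cSMC}(M,\theta,z)$ produces $\zeta=(\zeta_t^{(i)})_{1\le t\le T,\,1\le i\le M}$ as follows: $\zeta_t^{(1)}=z_t$ for all $t$; for $i\ge2$, independently, $\zeta_1^{(i)}\sim h_\theta$ and, for $t\ge 2$, given $\zeta_{t-1}$, an index $a$ is drawn with probability proportional to $w_{\theta,t-1}(\zeta_{t-1}^{(a)})$ and $\zeta_t^{(i)}\sim H_{\theta,t}(\zeta_{t-1}^{(a)},\cdot)$. For $\mathbf k\in\{1,\dots,M\}^T$ put $\zeta^{(\mathbf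 k)}=(\zeta_1^{(k_1)},\dots,\zeta_T^{(k_T)})$ and define the backward-sampling probabilities $$\phi_\theta(\mathbf k\mid\zeta)=\frac{w_{\theta,T}(\zeta_T^{(k_T)})}{\sum_{i}w_{\theta,T}(\zeta_T^{(i)})}\prod_{t=1}^{T-1}\frac{w_{\theta,t}(\zeta_t^{(k_t)})f_\theta(\zeta_t^{(k_t)},\zeta_{t+1}^{(k_{t+1})})}{\sum_{i}w_{\theta,t}(\zeta_t^{(i)})f_\theta(\zeta_t^{(i)},\zeta_{t+1}^{(k_{t+1})})}.$$ When all the weights of a finite distribution are zero (or their sum is infinite), the uniform distribution is used. **Acceptance ratio estimator.** Let $$\mathring r_{z,z'}(\theta,\theta';\tilde\theta)=\frac{q(\theta',\theta)\eta(\theta')p_{\theta'}(z',y)p_{\tilde\theta}(z,y)}{q(\theta,\theta')\eta(\theta)p_{\tilde\theta}(z',y)p_{\theta}(z,y)},\qquad \mathring r_{z,\zeta}(\theta,\theta';\tilde\theta)=\sum_{\mathbf k\in\{1,\dots,M\}^T}\phi_{\tilde\theta}(\mathbf k\mid\zeta)\,\mathring r_{z,\zeta^{(\mathbf k)}}(\theta,\theta';\tilde\theta),$$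 with values in $[0,\infty]$ and the conventions $0/0=0\cdot\infty=0$, $a/0=\infty$ for $a>0$, $1/\infty=0$. **Algorithm.** From the current state $(\theta,z)$, sample $\theta'\sim q(\theta,\cdot)$ and perform one of the following two moves, each with probability $1/2$. 1. Set $\tilde\theta=\tilde\theta_1(\theta,\theta')$ and run $\mathrm{cSMC}(M,\tilde\theta,z)$ to obtain $\zeta$. Sample $\mathbf k$ with probability proportional to $\phi_{\tilde\theta}(\mathbf k\mid\zeta)\,\mathring r_{z,\zeta^{(\mathbf k)}}(\theta,\theta';\tilde\theta)$ and set $z'=\zeta^{(\mathbf k)}$. Move to $(\theta',z')$ with probability $\min\{1,\mathring r_{z,\zeta}(\theta,\theta';\tilde\theta)\}$; otherwise stay at $(\theta,z)$. 2. Set $\tilde\theta=\tilde\theta_2(\theta,\theta')$ and run $\mathrm{cSMC}(M,\tilde\theta,z)$ to obtain $\zeta$. Sample $\mathbf k$ with probability $\phi_{\tilde\theta}(\mathbf k\mid\zeta)$ and set $z'=\zeta^{(\mathbf k)}$. Move to $(\theta',z')$ with probability $\min\{1,1/\mathring r_{z',\zeta}(\theta',\theta;\tilde\theta)\}$; otherwise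 stay at $(\theta,z)$. **Theorem.** For all $T\ge1$ and $M\ge1$, the transition kernel $P$ of this algorithm satisfies detailed balance with respect to $\pi$: for all measurable $A,B\subseteq\Theta\times\mathsf Z^T$, $\int_A\pi(\mathrm dx)P(x,B)=\int_B\pi(\mathrm dx)P(x,A)$. -/

import Mathlib

open MeasureTheory ProbabilityTheory
open scoped ENNReal NNReal

noncomputable section

namespace MHAAR

/-! ### Elementary sampling steps -/

section Sampling

variable {α β ι : Type*} [MeasurableSpace α] [MeasurableSpace β]

/-- The probabilities of the distribution `𝒫(w)` on a finite set, for which `ℙ(k)` is proportional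
to `w k`. When the total weight is `0` or `∞` the distribution `𝒫(w)` is not defined in the
mathematical sense, and the uniform distribution is used as a default. -/
def catProb [Fintype ι] (w : ι → ℝ≥0∞) (k : ι) : ℝ≥0∞ :=
  open scoped Classical in
  if (∑ j, w j) = 0 ∨ (∑ j, w j) = ∞ then (Fintype.card ι : ℝ≥0∞)⁻¹ else w k / ∑ j, w j

theorem sum_catProb [Fintype ι] [Nonempty ι] (w : ι → ℝ≥0∞) : ∑ k, catProb w k = 1 := by
  unfold catProb
  split_ifs with h
  · simp only [Finset.sum_const, Finset.card_univ, nsmul_eq_mul]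
    exact ENNReal.mul_inv_cancel (by simp) (by simp)
  · push Not at h
    simp_rw [div_eq_mul_inv]
    rw [← Finset.sum_mul]
    exact ENNReal.mul_inv_cancel h.1 h.2

theorem measurable_catProb [Fintype ι] {w : α → ι → ℝ≥0∞} (hw : ∀ i, Measurable fun a => w a i)
    (k : ι) : Measurable fun a => catProb (w a) k := by
  unfold catProb
  have hs : Measurable fun a => ∑ j, w a j := Finset.measurable_fun_sum _ fun j _ => hw j
  refine Measurable.ite ?_ measurable_const ((hw k).div hs)
  exact (hs (measurableSet_singleton 0)).union (hs (measurableSet_singleton ∞))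

/-- A finite mixture `∑ k, p a k • κ k a` of kernels, with weights depending on the current
state: draw `k` with probability `p a k`, then draw from `κ k a`. -/
def mixture [Fintype ι] (p : α → ι → ℝ≥0∞) (hp : ∀ k, Measurable fun a => p a k)
    (κ : ι → Kernel α β) : Kernel α β where
  toFun a := ∑ k, p a k • κ k a
  measurable' := by
    refine Measure.measurable_of_measurable_coe _ fun s hs => ?_
    simp only [Measure.coe_finsetSum, Finset.sum_apply, Measure.smul_apply, smul_eq_mul]
    exact Finset.measurable_fun_sum _ fun k _ => (hp k).mul ((κ k).measurable_coe hs)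

theorem isMarkovKernel_mixture [Fintype ι] (p : α → ι → ℝ≥0∞)
    (hp : ∀ k, Measurable fun a => p a k) (κ : ι → Kernel α β) [∀ k, IsMarkovKernel (κ k)]
    (h1 : ∀ a, ∑ k, p a k = 1) : IsMarkovKernel (mixture p hp κ) := by
  refine ⟨fun a => ⟨?_⟩⟩
  change (∑ k, p a k • κ k a) Set.univ = 1
  simp [h1 a]

/-- Draw the coordinates of a vector independently, coordinate `i` from `κ i a`. -/
def piKernel [Fintype ι] (κ : ι → Kernel α β) [∀ i, IsMarkovKernel (κ i)] :
    Kernel α (ι → β) where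
  toFun a := Measure.pi fun i => κ i a
  measurable' := by
    refine Measurable.measure_of_isPiSystem_of_isProbabilityMeasure generateFrom_pi.symm
      isPiSystem_pi ?_
    rintro _ ⟨s, hs, rfl⟩
    simp only [Set.mem_pi, Set.mem_univ, true_imp_iff, Set.mem_ofPred_eq] at hs
    simp_rw [Measure.pi_pi]
    exact Finset.measurable_fun_prod _ fun i _ => (κ i).measurable_coe (hs i)

instance [Fintype ι] (κ : ι → Kernel α β) [∀ i, IsMarkovKernel (κ i)] :
    IsMarkovKernel (piKernel κ) :=
  ⟨fun a => inferInstanceAs (IsProbabilityMeasure (Measure.pi fun i => κ i a))⟩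

/-- The kernel with density `d a b` with respect to a fixed reference measure. -/
def densityKernel (ref : Measure β) [SigmaFinite ref] (d : α → β → ℝ≥0) : Kernel α β :=
  Kernel.withDensity (Kernel.const α ref) fun a b => (d a b : ℝ≥0∞)

theorem isMarkovKernel_densityKernel (ref : Measure β) [SigmaFinite ref] (d : α → β → ℝ≥0)
    (hd : Measurable (Function.uncurry d)) (h1 : ∀ a, ∫⁻ b, d a b ∂ref = 1) :
    IsMarkovKernel (densityKernel ref d) := by
  refine ⟨fun a => ⟨?_⟩⟩
  have hd' : Measurable (Function.uncurry fun a b => (d a b : ℝ≥0∞)) :=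
    measurable_coe_nnreal_ennreal.comp hd
  rw [densityKernel, Kernel.withDensity_apply' _ hd']
  simp [h1 a]

/-- The accept/reject step: move to `y a` with probability `min 1 (r a)`, stay at `x a`
otherwise. -/
def acceptReject (r : α → ℝ≥0∞) (hr : Measurable r) (y x : α → β) (hy : Measurable y)
    (hx : Measurable x) : Kernel α β where
  toFun a := min 1 (r a) • Measure.dirac (y a) + (1 - min 1 (r a)) • Measure.dirac (x a)
  measurable' := by
    refine Measure.measurable_of_measurable_coe _ fun s hs => ?_
    simp only [Measure.coe_add, Pi.add_apply, Measure.smul_apply, smul_eq_mul]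
    have h1 : Measurable fun a => min 1 (r a) := measurable_const.min hr
    exact (h1.mul (Measure.measurable_coe hs |>.comp (Measure.measurable_dirac.comp hy))).add
      ((measurable_const.sub h1).mul
        (Measure.measurable_coe hs |>.comp (Measure.measurable_dirac.comp hx)))

instance (r : α → ℝ≥0∞) (hr : Measurable r) (y x : α → β) (hy : Measurable y)
    (hx : Measurable x) : IsMarkovKernel (acceptReject r hr y x hy hx) := by
  refine ⟨fun a => ⟨?_⟩⟩
  change (min 1 (r a) • Measure.dirac (y a) + (1 - min 1 (r a)) • Measure.dirac (x a))
    Set.univ = 1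
  simp

theorem measurable_snoc (n : ℕ) :
    Measurable fun p : (Fin n → α) × α => (Fin.snoc p.1 p.2 : Fin (n + 1) → α) := by
  refine measurable_pi_iff.2 fun i => ?_
  refine Fin.lastCases ?_ (fun j => ?_) i
  · simpa using measurable_snd
  · simp only [Fin.snoc_castSucc]
    exact (measurable_pi_apply j).comp measurable_fst

theorem measurable_init (n : ℕ) :
    Measurable fun z : Fin (n + 1) → α => (Fin.init z : Fin n → α) :=
  measurable_pi_iff.2 fun j => measurable_pi_apply j.castSucc

end Sampling

/-! ### State-space models -/

/-- Trajectories `z = (z_1, …, z_T)` with `T = n + 1`; times are numbered `0, …, n`. -/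
abbrev Path (Z : Type*) (n : ℕ) : Type _ := Fin (n + 1) → Z

/-- Arrays of particles `ζ t i`, with time `t` and particle number `i`. Particle `0` is the
first one. -/
abbrev Particles (Z : Type*) (n M : ℕ) : Type _ := Fin (n + 1) → Fin M → Z

/-- The selected path `ζ^(𝐤)`. -/
def select {Z : Type*} {n M : ℕ} (ζ : Particles Z n M) (k : Fin (n + 1) → Fin M) : Path Z n :=
  fun t => ζ t (k t)

theorem measurable_select {Z : Type*} [MeasurableSpace Z] {n M : ℕ} (k : Fin (n + 1) → Fin M) :
    Measurable fun ζ : Particles Z n M => select ζ k :=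
  measurable_pi_iff.2 fun t => (measurable_pi_apply (k t)).comp (measurable_pi_apply t)

/-- A parametric state-space model, with prior density `η` and fixed reference measures
`ν` ("dθ") on the parameter space and `lam` ("dz") on the latent space: the initial density
`μ_θ(z)`, the transition density `f_θ(z, z')`, the observation density `g_θ(z, y)`. -/
structure StateSpaceModel (Θ Z Y : Type*) [MeasurableSpace Θ] [MeasurableSpace Z]
    (ν : Measure Θ) (lam : Measure Z) where
  η : Θ → ℝ≥0
  μ : Θ → Z → ℝ≥0
  f : Θ → Z → Z → ℝ≥0
  g : Θ → Z → Y → ℝ≥0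
  measurable_η : Measurable η
  measurable_μ : Measurable fun p : Θ × Z => μ p.1 p.2
  measurable_f : Measurable fun p : Θ × Z × Z => f p.1 p.2.1 p.2.2
  measurable_g : ∀ y, Measurable fun p : Θ × Z => g p.1 p.2 y
  lintegral_η : ∫⁻ θ, η θ ∂ν = 1
  lintegral_μ : ∀ θ, ∫⁻ z, μ θ z ∂lam = 1
  lintegral_f : ∀ θ z, ∫⁻ z', f θ z z' ∂lam = 1

/-- A proposal density `q(θ, θ')` for the parameter. -/
structure ParameterProposal (Θ : Type*) [MeasurableSpace Θ] (ν : Measure Θ) where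
  q : Θ → Θ → ℝ≥0
  measurable_q : Measurable (Function.uncurry q)
  lintegral_q : ∀ θ, ∫⁻ θ', q θ θ' ∂ν = 1

/-- The pair of functions `θ̃₁, θ̃₂ : Θ² → Θ` giving the intermediate parameter value. -/
structure IntermediateParameter (Θ : Type*) [MeasurableSpace Θ] where
  fst : Θ → Θ → Θ
  snd : Θ → Θ → Θ
  measurable_fst : Measurable (Function.uncurry fst)
  measurable_snd : Measurable (Function.uncurry snd)
  symm : ∀ θ θ', fst θ θ' = snd θ' θ

section Model

variable {Θ Z Y : Type*} [MeasurableSpace Θ] [MeasurableSpace Z]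
  {ν : Measure Θ} {lam : Measure Z}

/-- Particle proposals for the observations `y` (with a time horizon `n`, only `y 0, …, y n`, the
proposals `H t`, `t < n`, and the weights `w t`, `t ≤ n`, play a role): the initial density `h_θ`, the propagation
densities `H_θ` (`H t` propagates from time `t` to time `t + 1`), and the importance weights
`μ g / h` and `f g / H`, which are functions `w t θ` of the current particle only. The bootstrap
particle filter is `h = μ`, `H t = f`, `w t θ z = g θ z (y t)`. -/
structure ParticleProposal (S : StateSpaceModel Θ Z Y ν lam) (y : ℕ → Y) where
  h : Θ → Z → ℝ≥0
  H : ℕ → Θ → Z → Z → ℝ≥0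
  w : ℕ → Θ → Z → ℝ≥0
  measurable_h : Measurable fun p : Θ × Z => h p.1 p.2
  measurable_H : ∀ t, Measurable fun p : Θ × Z × Z => H t p.1 p.2.1 p.2.2
  measurable_w : ∀ t, Measurable fun p : Θ × Z => w t p.1 p.2
  lintegral_h : ∀ θ, ∫⁻ z, h θ z ∂lam = 1
  lintegral_H : ∀ t θ z, ∫⁻ z', H t θ z z' ∂lam = 1
  w_zero : ∀ θ z, w 0 θ z * h θ z = S.μ θ z * S.g θ z (y 0)
  w_succ : ∀ t θ z z', w (t + 1) θ z' * H t θ z z' = S.f θ z z' * S.g θ z' (y (t + 1))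

namespace StateSpaceModel

variable (S : StateSpaceModel Θ Z Y ν lam) (y : ℕ → Y)

/-- The joint density `p_θ(z, y)` of the latent path and of the observations `y_0, …, y_n`. -/
def jointDensity {n : ℕ} (θ : Θ) (z : Path Z n) : ℝ≥0 :=
  S.μ θ (z 0) * (∏ t : Fin n, S.f θ (z t.castSucc) (z t.succ)) *
    ∏ t : Fin (n + 1), S.g θ (z t) (y t)

theorem measurable_jointDensity {n : ℕ} :
    Measurable fun p : Θ × Path Z n => S.jointDensity y p.1 p.2 := by
  have hc (t : Fin (n + 1)) : Measurable fun p : Θ × Path Z n => p.2 t :=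
    (measurable_pi_apply t).comp measurable_snd
  refine ((S.measurable_μ.comp (measurable_fst.prodMk (hc 0))).mul ?_).mul ?_
  · exact Finset.measurable_fun_prod _ fun t _ =>
      S.measurable_f.comp (measurable_fst.prodMk ((hc _).prodMk (hc _)))
  · exact Finset.measurable_fun_prod _ fun t _ =>
      (S.measurable_g _).comp (measurable_fst.prodMk (hc _))

/-- The measure with density `η(θ) p_θ(z, y)` with respect to `dθ dz_0 ⋯ dz_n`. -/
def unnormalisedPosterior [SigmaFinite lam] (n : ℕ) : Measure (Θ × Path Z n) :=
  (ν.prod (Measure.pi fun _ : Fin (n + 1) => lam)).withDensity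
    fun x => (S.η x.1 * S.jointDensity y x.1 x.2 : ℝ≥0)

/-- The joint posterior distribution `π(d(θ, z))`, with density proportional to
`η(θ) p_θ(z, y)`. -/
def posterior [SigmaFinite lam] (n : ℕ) : Measure (Θ × Path Z n) :=
  (S.unnormalisedPosterior y n Set.univ)⁻¹ • S.unnormalisedPosterior y n

/-- The ratio `r̊_{z,z'}(θ, θ'; θ̃)`. -/
def pathRatio (Q : ParameterProposal Θ ν) {n : ℕ} (z z' : Path Z n) (θ θ' θt : Θ) : ℝ≥0∞ :=
  (Q.q θ' θ * S.η θ' * S.jointDensity y θ' z' * S.jointDensity y θt z : ℝ≥0) /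
    (Q.q θ θ' * S.η θ * S.jointDensity y θt z' * S.jointDensity y θ z : ℝ≥0)

theorem measurable_pathRatio (Q : ParameterProposal Θ ν) {n : ℕ} {α : Type*} [MeasurableSpace α]
    {z z' : α → Path Z n} {θ θ' θt : α → Θ} (hz : Measurable z) (hz' : Measurable z')
    (hθ : Measurable θ) (hθ' : Measurable θ') (hθt : Measurable θt) :
    Measurable fun a => S.pathRatio y Q (z a) (z' a) (θ a) (θ' a) (θt a) := by
  have hp {θ : α → Θ} {z : α → Path Z n} (hθ : Measurable θ) (hz : Measurable z) :
      Measurable fun a => S.jointDensity y (θ a) (z a) :=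
    (S.measurable_jointDensity y).comp (hθ.prodMk hz)
  have hq {θ θ' : α → Θ} (hθ : Measurable θ) (hθ' : Measurable θ') :
      Measurable fun a => Q.q (θ a) (θ' a) := Q.measurable_q.comp (hθ.prodMk hθ')
  exact ((((hq hθ' hθ).mul (S.measurable_η.comp hθ')).mul (hp hθ' hz')).mul
    (hp hθt hz)).coe_nnreal_ennreal.div
    ((((hq hθ hθ').mul (S.measurable_η.comp hθ)).mul (hp hθt hz')).mul
    (hp hθ hz)).coe_nnreal_ennreal

end StateSpaceModel

namespace ParticleProposal

variable {S : StateSpaceModel Θ Z Y ν lam} {y : ℕ → Y} (A : ParticleProposal S y)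

/-! ### The conditional SMC algorithm -/

section CSMC

variable [SigmaFinite lam] (M : ℕ) [NeZero M]

/-- One particle drawn from `h_θ`. -/
def initialMove : Kernel (Θ × Z) Z := densityKernel lam fun p z => A.h p.1 z

instance : IsMarkovKernel A.initialMove :=
  isMarkovKernel_densityKernel _ _
    (A.measurable_h.comp ((measurable_fst.comp measurable_fst).prodMk measurable_snd))
    fun _ => A.lintegral_h _

/-- One particle at time `t + 1` drawn by multinomial resampling and propagation: given the
particles `ζ` at time `t`, draw an ancestor `a ∼ 𝒫(w_t(ζ^1), …, w_t(ζ^M))`, then draw from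
`H_θ(ζ^a, ·)`. The input `(θ, z, ζ)` also holds the retained state `z`, which is not used. -/
def resampleMove (t : ℕ) : Kernel (Θ × Z × (Fin M → Z)) Z :=
  mixture (fun p a => catProb (fun j => (A.w t p.1 (p.2.2 j) : ℝ≥0∞)) a)
    (measurable_catProb fun j => ((A.measurable_w t).comp (measurable_fst.prodMk
      ((measurable_pi_apply j).comp measurable_snd.snd))).coe_nnreal_ennreal)
    fun a => densityKernel lam fun p z' => A.H t p.1 (p.2.2 a) z'

instance (t : ℕ) : IsMarkovKernel (A.resampleMove M t) := by
  have (a : Fin M) : IsMarkovKernel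
      (densityKernel lam fun (p : Θ × Z × (Fin M → Z)) z' => A.H t p.1 (p.2.2 a) z') :=
    isMarkovKernel_densityKernel _ _
      ((A.measurable_H t).comp (f := fun b : (Θ × Z × (Fin M → Z)) × Z =>
        (b.1.1, b.1.2.2 a, b.2)) (by fun_prop))
      fun _ => A.lintegral_H _ _ _
  exact isMarkovKernel_mixture _ _ _ fun _ => sum_catProb _

/-- Particle number `i` of a generation: the retained state `z` for the first particle, a draw
from `κ` for the other ones. -/
def retainOr {β : Type*} [MeasurableSpace β] (κ : Kernel (Θ × Z × β) Z) (i : Fin M) :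
    Kernel (Θ × Z × β) Z :=
  if i = 0 then Kernel.deterministic (fun p => p.2.1) measurable_snd.fst else κ

instance {β : Type*} [MeasurableSpace β] (κ : Kernel (Θ × Z × β) Z) [IsMarkovKernel κ]
    (i : Fin M) : IsMarkovKernel (retainOr (Θ := Θ) (Z := Z) M κ i) := by
  unfold retainOr
  split_ifs <;> infer_instance

/-- The law of the particles `ζ` produced by `cSMC(M, θ, z)` up to time `n`: all particles of
a generation are drawn independently given the previous generation, except that the first
particle at time `t` is `z_t`. -/
def csmc : (n : ℕ) → Kernel (Θ × Path Z n) (Particles Z n M)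
  | 0 => ((piKernel (retainOr M (A.initialMove.comap
        (fun p : Θ × Z × Unit => (p.1, p.2.1)) (by fun_prop)))).comap
        (fun p : Θ × Path Z 0 => (p.1, p.2 0, ())) (by fun_prop)).map (fun ξ _ => ξ)
  | n + 1 =>
      (((csmc n).comap (fun p : Θ × Path Z (n + 1) => (p.1, Fin.init p.2))
          (measurable_fst.prodMk ((measurable_init (n + 1)).comp measurable_snd))) ⊗ₖ
        (piKernel (retainOr M (A.resampleMove M n))).comap
          (fun p : (Θ × Path Z (n + 1)) × Particles Z n M =>
            (p.1.1, p.1.2 (Fin.last (n + 1)), p.2 (Fin.last n))) (by fun_prop)).map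
      (fun p => Fin.snoc p.1 p.2)

instance isMarkovKernel_csmc : (n : ℕ) → IsMarkovKernel (A.csmc M n)
  | 0 => by
      unfold csmc
      exact Kernel.IsMarkovKernel.map _ (by fun_prop)
  | n + 1 => by
      have := isMarkovKernel_csmc n
      unfold csmc
      exact Kernel.IsMarkovKernel.map _ (measurable_snoc (n + 1))

end CSMC

/-! ### Backward sampling and the Rao–Blackwellised ratio estimator -/

section Backward

variable {M n : ℕ}

/-- The probability `φ_θ(𝐤 | ζ)` of the indices `𝐤` in backward sampling: the last index is
drawn from `𝒫(w_n(ζ_n^i))`, then, backwards in time, `k_t` is drawn from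
`𝒫(w_t(ζ_t^i) f_θ(ζ_t^i, ζ_{t+1}^{k_{t+1}}))`. -/
def backwardProb (θ : Θ) (ζ : Particles Z n M) (k : Fin (n + 1) → Fin M) : ℝ≥0∞ :=
  catProb (fun i => (A.w n θ (ζ (Fin.last n) i) : ℝ≥0∞)) (k (Fin.last n)) *
    ∏ t : Fin n, catProb
      (fun i => (A.w t θ (ζ t.castSucc i) * S.f θ (ζ t.castSucc i) (ζ t.succ (k t.succ)) : ℝ≥0))
      (k t.castSucc)

/-- The Rao–Blackwellised estimator `r̊_{z,ζ}(θ, θ'; θ̃)`, which uses all paths. -/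
def allPathsRatio (Q : ParameterProposal Θ ν) (z : Path Z n) (ζ : Particles Z n M)
    (θ θ' θt : Θ) : ℝ≥0∞ :=
  ∑ k : Fin (n + 1) → Fin M, A.backwardProb θt ζ k * S.pathRatio y Q z (select ζ k) θ θ' θt

variable {α : Type*} [MeasurableSpace α]

theorem measurable_backwardProb {θ : α → Θ} {ζ : α → Particles Z n M} (hθ : Measurable θ)
    (hζ : Measurable ζ) (k : Fin (n + 1) → Fin M) :
    Measurable fun a => A.backwardProb (θ a) (ζ a) k := by
  have hc (t : Fin (n + 1)) (i : Fin M) : Measurable fun a => ζ a t i :=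
    (measurable_pi_apply i).comp ((measurable_pi_apply t).comp hζ)
  refine (measurable_catProb (fun i =>
    ((A.measurable_w n).comp (hθ.prodMk (hc _ i))).coe_nnreal_ennreal) _).mul ?_
  refine Finset.measurable_fun_prod _ fun t _ => measurable_catProb (fun i => ?_) _
  exact (((A.measurable_w t).comp (hθ.prodMk (hc _ i))).mul
    (S.measurable_f.comp (hθ.prodMk ((hc _ i).prodMk (hc _ _))))).coe_nnreal_ennreal

theorem measurable_allPathsRatio (Q : ParameterProposal Θ ν) {z : α → Path Z n}
    {ζ : α → Particles Z n M} {θ θ' θt : α → Θ} (hz : Measurable z) (hζ : Measurable ζ)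
    (hθ : Measurable θ) (hθ' : Measurable θ') (hθt : Measurable θt) :
    Measurable fun a => A.allPathsRatio Q (z a) (ζ a) (θ a) (θ' a) (θt a) :=
  Finset.measurable_fun_sum _ fun k _ => (A.measurable_backwardProb hθt hζ k).mul
    (S.measurable_pathRatio y Q hz ((measurable_select k).comp hζ) hθ hθ' hθt)

/-- The backward-sampling probabilities `φ_θ(𝐤 | ζ)` sum to one over `𝐤`. -/
theorem sum_backwardProb [NeZero M] (θ : Θ) (ζ : Particles Z n M) :
    ∑ k, A.backwardProb θ ζ k = 1 := by
  -- summing over the indices forward in time, one index at a time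
  have key : ∀ (m : ℕ) (c : (t : Fin m) → Fin M → Fin M → ℝ≥0∞) (d : Fin M → ℝ≥0∞),
      (∀ t j, ∑ i, c t j i = 1) → (∑ i, d i = 1) →
      ∑ k : Fin (m + 1) → Fin M,
        d (k (Fin.last m)) * ∏ t : Fin m, c t (k t.succ) (k t.castSucc) = 1 := by
    intro m
    induction m with
    | zero =>
      intro c d _ hd
      rw [← hd]
      refine Fintype.sum_equiv (Equiv.funUnique (Fin 1) (Fin M)) _ _ fun k => ?_
      simp [Equiv.funUnique]
    | succ m ih =>
      intro c d hc hd
      rw [← (Fin.consEquiv fun _ : Fin (m + 2) => Fin M).sum_comp, Fintype.sum_prod_type_right]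
      refine Eq.trans ?_ (ih (fun t => c t.succ) d (fun t j => hc _ j) hd)
      refine Finset.sum_congr rfl fun k _ => ?_
      have h0 : ∀ x : Fin M, d ((Fin.consEquiv fun _ : Fin (m + 2) => Fin M) (x, k)
            (Fin.last (m + 1))) *
          ∏ t : Fin (m + 1), c t ((Fin.consEquiv fun _ : Fin (m + 2) => Fin M) (x, k) t.succ)
            ((Fin.consEquiv fun _ : Fin (m + 2) => Fin M) (x, k) t.castSucc) =
          c 0 (k 0) x * (d (k (Fin.last m)) *
            ∏ t : Fin m, c t.succ (k t.succ) (k t.castSucc)) := by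
        intro x
        rw [Fin.prod_univ_succ]
        simp only [Fin.consEquiv_apply, ← Fin.succ_last, Fin.cons_succ, Fin.castSucc_zero,
          Fin.cons_zero, ← Fin.succ_castSucc]
        ring
      rw [Finset.sum_congr rfl fun x _ => h0 x, ← Finset.sum_mul, hc, one_mul]
  exact key n (fun t j i => catProb (fun i => (A.w t θ (ζ t.castSucc i) *
    S.f θ (ζ t.castSucc i) (ζ t.succ j) : ℝ≥0)) i) _ (fun _ _ => sum_catProb _) (sum_catProb _)

end Backward

/-! ### The MHAAR transition kernel -/

section Algorithm

variable [SigmaFinite ν] [SigmaFinite lam] (Q : ParameterProposal Θ ν)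
  (I : IntermediateParameter Θ) (M : ℕ) [NeZero M] (n : ℕ)

/-- Sample `θ' ∼ q(θ, ·)`. -/
def proposeParameter : Kernel (Θ × Path Z n) Θ := densityKernel ν fun x θ' => Q.q x.1 θ'

instance : IsMarkovKernel (proposeParameter (Z := Z) Q n) :=
  isMarkovKernel_densityKernel _ _
    (Q.measurable_q.comp ((measurable_fst.comp measurable_fst).prodMk measurable_snd))
    fun _ => Q.lintegral_q _

/-- The first selection step. Given the current state `(θ, z)`, the proposed parameter `θ'` and
the particles `ζ` of the cSMC run at `θ̃ = θ̃₁(θ, θ')`: sample `𝐤` with probability proportional to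
`φ_θ̃(𝐤 | ζ) r̊_{z,ζ^(𝐤)}(θ, θ'; θ̃)`, set `z' = ζ^(𝐤)`, and move to `(θ', z')` with probability
`min {1, r̊_{z,ζ}(θ, θ'; θ̃)}`. -/
def selectFirst : Kernel ((Θ × Path Z n) × Θ × Particles Z n M) (Θ × Path Z n) :=
  mixture
    (fun a k => catProb (fun l : Fin (n + 1) → Fin M =>
      A.backwardProb (I.fst a.1.1 a.2.1) a.2.2 l *
        S.pathRatio y Q a.1.2 (select a.2.2 l) a.1.1 a.2.1 (I.fst a.1.1 a.2.1)) k)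
    (measurable_catProb fun l =>
      (A.measurable_backwardProb (I.measurable_fst.comp
        (measurable_fst.fst.prodMk measurable_snd.fst)) measurable_snd.snd l).mul
      (S.measurable_pathRatio y Q measurable_fst.snd
        ((measurable_select l).comp measurable_snd.snd) measurable_fst.fst measurable_snd.fst
        (I.measurable_fst.comp (measurable_fst.fst.prodMk measurable_snd.fst))))
    fun k => acceptReject
      (fun a => A.allPathsRatio Q a.1.2 a.2.2 a.1.1 a.2.1 (I.fst a.1.1 a.2.1))
      (A.measurable_allPathsRatio Q measurable_fst.snd measurable_snd.snd measurable_fst.fst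
        measurable_snd.fst (I.measurable_fst.comp (measurable_fst.fst.prodMk measurable_snd.fst)))
      (fun a => (a.2.1, select a.2.2 k)) (fun a => a.1)
      (measurable_snd.fst.prodMk ((measurable_select k).comp measurable_snd.snd)) measurable_fst

instance : IsMarkovKernel (A.selectFirst Q I M n) :=
  isMarkovKernel_mixture _ _ _ fun _ => sum_catProb _

/-- The second selection step. Given the current state `(θ, z)`, the proposed parameter `θ'` and
the particles `ζ` of the cSMC run at `θ̃ = θ̃₂(θ, θ')`: sample `𝐤` with probability
`φ_θ̃(𝐤 | ζ)`, set `z' = ζ^(𝐤)`, and move to `(θ', z')` with probability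
`min {1, 1 / r̊_{z',ζ}(θ', θ; θ̃)}`. -/
def selectSecond : Kernel ((Θ × Path Z n) × Θ × Particles Z n M) (Θ × Path Z n) :=
  mixture
    (fun a (k : Fin (n + 1) → Fin M) => A.backwardProb (I.snd a.1.1 a.2.1) a.2.2 k)
    (A.measurable_backwardProb (I.measurable_snd.comp
      (measurable_fst.fst.prodMk measurable_snd.fst)) measurable_snd.snd)
    fun k => acceptReject
      (fun a => 1 / A.allPathsRatio Q (select a.2.2 k) a.2.2 a.2.1 a.1.1 (I.snd a.1.1 a.2.1))
      (measurable_const.div (A.measurable_allPathsRatio Q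
        ((measurable_select k).comp measurable_snd.snd) measurable_snd.snd measurable_snd.fst
        measurable_fst.fst (I.measurable_snd.comp
          (measurable_fst.fst.prodMk measurable_snd.fst))))
      (fun a => (a.2.1, select a.2.2 k)) (fun a => a.1)
      (measurable_snd.fst.prodMk ((measurable_select k).comp measurable_snd.snd)) measurable_fst

instance : IsMarkovKernel (A.selectSecond Q I M n) :=
  isMarkovKernel_mixture _ _ _ fun _ => A.sum_backwardProb _ _

/-- One of the two moves: sample `θ' ∼ q(θ, ·)`, run `cSMC(M, θ̃, z)` at `θ̃ = c(θ, θ')` to obtain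
`ζ`, then apply the selection step `sel`. -/
def move (c : Θ → Θ → Θ) (hc : Measurable (Function.uncurry c))
    (sel : Kernel ((Θ × Path Z n) × Θ × Particles Z n M) (Θ × Path Z n)) :
    Kernel (Θ × Path Z n) (Θ × Path Z n) :=
  ((proposeParameter Q n ⊗ₖ (A.csmc M n).comap
      (fun b : (Θ × Path Z n) × Θ => (c b.1.1 b.2, b.1.2))
      ((hc.comp (measurable_fst.fst.prodMk measurable_snd)).prodMk measurable_fst.snd)) ⊗ₖ
    sel).snd

instance (c : Θ → Θ → Θ) (hc : Measurable (Function.uncurry c))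
    (sel : Kernel ((Θ × Path Z n) × Θ × Particles Z n M) (Θ × Path Z n)) [IsMarkovKernel sel] :
    IsMarkovKernel (A.move Q M n c hc sel) := by
  unfold move
  have : IsMarkovKernel ((A.csmc M n).comap
      (fun b : (Θ × Path Z n) × Θ => (c b.1.1 b.2, b.1.2))
      ((hc.comp (measurable_fst.fst.prodMk measurable_snd)).prodMk measurable_fst.snd)) :=
    Kernel.IsMarkovKernel.comap _ _
  have := Kernel.IsMarkovKernel.compProd (proposeParameter (Z := Z) Q n) ((A.csmc M n).comap
      (fun b : (Θ × Path Z n) × Θ => (c b.1.1 b.2, b.1.2))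
      ((hc.comp (measurable_fst.fst.prodMk measurable_snd)).prodMk measurable_fst.snd))
  infer_instance

/-- The transition kernel of the MHAAR algorithm for state-space models with the
Rao–Blackwellised all-paths cSMC estimator: each of the two moves is used with
probability `1/2`. -/
def mhaarKernel : Kernel (Θ × Path Z n) (Θ × Path Z n) :=
  mixture (ι := Fin 2) (fun _ _ => 1 / 2) (fun _ => measurable_const)
    ![A.move Q M n I.fst I.measurable_fst (A.selectFirst Q I M n),
      A.move Q M n I.snd I.measurable_snd (A.selectSecond Q I M n)]

instance : IsMarkovKernel (A.mhaarKernel Q I M n) := by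
  have (i : Fin 2) : IsMarkovKernel
      ((![A.move Q M n I.fst I.measurable_fst (A.selectFirst Q I M n),
        A.move Q M n I.snd I.measurable_snd (A.selectSecond Q I M n)] :
        Fin 2 → Kernel (Θ × Path Z n) (Θ × Path Z n)) i) := by
    fin_cases i
    · change IsMarkovKernel (A.move Q M n I.fst I.measurable_fst (A.selectFirst Q I M n))
      infer_instance
    · change IsMarkovKernel (A.move Q M n I.snd I.measurable_snd (A.selectSecond Q I M n))
      infer_instance
  exact isMarkovKernel_mixture _ _ _ fun _ => by
    simpa using ENNReal.mul_inv_cancel two_ne_zero ENNReal.ofNat_ne_top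

end Algorithm

end ParticleProposal

end Model

end MHAAR

end

/-! Move 1 from `(θ, z)` and move 2 back from `(θ', z')` run conditional SMC at the same parameter,
because `θ̃₁(θ, θ') = θ̃₂(θ', θ)`. It is therefore enough to show, for fixed `θ`, `θ'` and `θ̃`,
that the accepted flow of move 1 from `B` to `C` equals that of move 2 from `C` to `B`. Rejected
moves stay in place and contribute symmetric terms whatever the rejection probability.

Two facts give this balance. The first is the reversibility of conditional SMC with backward
sampling. If the retained path is integrated against the reference measure, retained path and
particles have an explicit joint density (`lintegral_csmc`). Its product with `p_θ̃(z)` and `φ_θ̃(𝐤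
| ζ)` is `backwardJoint`, which is invariant under exchanging the retained path with `ζ^(𝐤)` in
every generation (`backwardJoint_swapPaths`). Indeed the backward probability times the forward
densities of the selected particles is `p_θ̃(ζ^(𝐤))` times a quantity that ignores labels
(`backwardProb_mul_prod`).

The second is the Metropolis–Hastings identity `min 1 s = s * min 1 (1 / s)`, applied to the sum
over all paths (`catProb_mul_min_one`). It turns selection proportional to `φ r̊` into selection
from `φ`. Both flows thus become integrals of `backwardJoint` against the same function,
`acceptedFlow`, evaluated at `ζ` for move 1 and at the swapped particles for move 2. The estimator
sums over all paths, so it does not see the swap, and the swap preserves the product measure.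

Most of the remaining care concerns zeros: paths of zero density, vanishing weight sums and the
values `0` and `∞` of the ratio. The support hypothesis ensures that dividing by `p_θ̃` loses no
mass. -/

noncomputable section

namespace MHAAR

/-! ### Integration over product measures, one coordinate at a time -/

section Pi

variable {α : Type*} [MeasurableSpace α]

theorem measurable_finCons (n : ℕ) :
    Measurable fun p : α × (Fin n → α) => (Fin.cons p.1 p.2 : Fin (n + 1) → α) := by
  refine measurable_pi_iff.2 fun i => ?_
  refine Fin.cases ?_ (fun j => ?_) i
  · simpa using measurable_fst
  · simp only [Fin.cons_succ]
    exact (measurable_pi_apply j).comp measurable_snd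

theorem lintegral_pi_cons {n : ℕ} (μ : Fin (n + 1) → Measure α) [∀ i, SigmaFinite (μ i)]
    {f : (Fin (n + 1) → α) → ℝ≥0∞} (hf : Measurable f) :
    ∫⁻ ξ, f ξ ∂Measure.pi μ =
      ∫⁻ x, ∫⁻ ξ, f (Fin.cons x ξ) ∂Measure.pi (fun i : Fin n => μ i.succ) ∂μ 0 := by
  have hm : Measurable fun p : α × (Fin n → α) => f (Fin.cons p.1 p.2) :=
    hf.comp (measurable_finCons n)
  rw [← lintegral_prod (fun p : α × (Fin n → α) => f (Fin.cons p.1 p.2)) hm.aemeasurable]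
  have h := (measurePreserving_piFinSuccAbove μ 0).lintegral_comp hm
  rw [show (fun i : Fin n => μ i.succ) = fun i => μ (Fin.succAbove 0 i) by simp, ← h]
  refine lintegral_congr fun ξ => ?_
  congr 1
  exact (Fin.cons_self_tail ξ).symm

/-- Fubini with the last coordinate innermost: this matches the recursion of `csmc`, which appends
generations at the end. -/
theorem lintegral_pi_snoc {n : ℕ} (μ : Measure α) [SigmaFinite μ]
    {f : (Fin (n + 1) → α) → ℝ≥0∞} (hf : Measurable f) :
    ∫⁻ ξ, f ξ ∂Measure.pi (fun _ => μ) =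
      ∫⁻ ξ, ∫⁻ x, f (Fin.snoc ξ x) ∂μ ∂Measure.pi (fun _ : Fin n => μ) := by
  have hm : Measurable fun p : (Fin n → α) × α => f (Fin.snoc p.1 p.2) :=
    hf.comp (measurable_snoc n)
  have hm' : Measurable fun p : α × (Fin n → α) => f (Fin.snoc p.2 p.1) :=
    hm.comp measurable_swap
  rw [← lintegral_lintegral_swap hm'.aemeasurable,
    ← lintegral_prod (fun p : α × (Fin n → α) => f (Fin.snoc p.2 p.1)) hm'.aemeasurable]
  have h := (measurePreserving_piFinSuccAbove (fun _ : Fin (n + 1) => μ)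
    (Fin.last n)).lintegral_comp hm'
  rw [← h]
  refine lintegral_congr fun ξ => ?_
  congr 1
  have : (MeasurableEquiv.piFinSuccAbove (fun _ : Fin (n + 1) => α) (Fin.last n)) ξ =
      (ξ (Fin.last n), Fin.init ξ) := by
    ext <;> simp [MeasurableEquiv.piFinSuccAbove, Fin.init, Fin.insertNthEquiv]
  rw [this]
  exact (Fin.snoc_init_self ξ).symm

theorem lintegral_pi_withDensity (μ : Measure α) [SigmaFinite μ] {g : α → ℝ≥0∞}
    (hg : Measurable g) [SigmaFinite (μ.withDensity g)] : ∀ (n : ℕ) {f : (Fin n → α) → ℝ≥0∞},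
    Measurable f → ∫⁻ ξ, f ξ ∂Measure.pi (fun _ => μ.withDensity g) =
      ∫⁻ ξ, (∏ i, g (ξ i)) * f ξ ∂Measure.pi (fun _ => μ)
  | 0, f, _ => by simp [Measure.pi_of_empty (x := Fin.elim0)]
  | n + 1, f, hf => by
    have hp (n : ℕ) : Measurable fun ξ : Fin n → α => ∏ i, g (ξ i) :=
      Finset.measurable_fun_prod _ fun i _ => hg.comp (measurable_pi_apply i)
    have hc : Measurable fun p : α × (Fin n → α) => f (Fin.cons p.1 p.2) :=
      hf.comp (measurable_finCons n)
    rw [lintegral_pi_cons _ hf, lintegral_pi_cons _ (f := fun ξ => (∏ i, g (ξ i)) * f ξ) ((hp _).mul hf),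
      lintegral_withDensity_eq_lintegral_mul _ hg hc.lintegral_prod_right']
    refine lintegral_congr fun x => ?_
    have hx : Measurable fun ξ : Fin n → α => f (Fin.cons x ξ) := hc.comp measurable_prodMk_left
    simp only [Pi.mul_apply]
    rw [lintegral_pi_withDensity μ hg n hx, 
      ← lintegral_const_mul _ (f := fun ξ => (∏ i, g (ξ i)) * f (Fin.cons x ξ)) ((hp n).mul hx)]
    simp [Fin.prod_univ_succ, mul_assoc]

/-- A generation of particles, the first one drawn from `μ` and the other ones from the density
`g`, has density `∏ i ≠ 0, g (ξ i)`. -/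
theorem lintegral_pi_retain {M : ℕ} [NeZero M] (μ : Measure α) [SigmaFinite μ] {g : α → ℝ≥0∞}
    (hg : Measurable g) [SigmaFinite (μ.withDensity g)] {f : α → (Fin M → α) → ℝ≥0∞}
    (hf : Measurable (Function.uncurry f)) (κ : Fin M → α → Measure α)
    (h0 : ∀ x, κ 0 x = Measure.dirac x) (hκ : ∀ i x, i ≠ 0 → κ i x = μ.withDensity g) :
    ∫⁻ x, ∫⁻ ξ, f x ξ ∂Measure.pi (fun i => κ i x) ∂μ =
      ∫⁻ ξ, (∏ i ∈ Finset.univ.erase 0, g (ξ i)) * f (ξ 0) ξ ∂Measure.pi (fun _ => μ) := by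
  obtain ⟨m, rfl⟩ := Nat.exists_eq_succ_of_ne_zero (NeZero.ne M)
  have hs (x : α) (i : Fin (m + 1)) : SigmaFinite (κ i x) := by
    rcases eq_or_ne i 0 with rfl | hi
    · rw [h0]; infer_instance
    · rw [hκ i x hi]; infer_instance
  have he : (Finset.univ.erase (0 : Fin (m + 1))) = Finset.univ.map (Fin.succEmb m) := by
    ext i; cases i using Fin.cases <;> simp [Fin.succ_ne_zero]
  have hp : Measurable fun ξ : Fin (m + 1) → α => ∏ i ∈ Finset.univ.erase 0, g (ξ i) :=
    Finset.measurable_fun_prod _ fun i _ => hg.comp (measurable_pi_apply i)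
  have hf0 : Measurable fun ξ : Fin (m + 1) → α => f (ξ 0) ξ :=
    hf.comp (f := fun ξ : Fin (m + 1) → α => (ξ 0, ξ))
      ((measurable_pi_apply 0).prodMk measurable_id)
  rw [lintegral_pi_cons _ (f := fun ξ => (∏ i ∈ Finset.univ.erase 0, g (ξ i)) * f (ξ 0) ξ)
    (hp.mul hf0)]
  refine lintegral_congr fun x => ?_
  have hfx : Measurable (f x) := hf.comp measurable_prodMk_left
  have hc : Measurable fun ξ : Fin m → α => f x (Fin.cons x ξ) :=
    hfx.comp ((measurable_finCons m).comp measurable_prodMk_left)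
  have hc' : Measurable fun p : α × (Fin m → α) => f x (Fin.cons p.1 p.2) :=
    hfx.comp (measurable_finCons m)
  rw [lintegral_pi_cons _ hfx, h0]
  simp only [hκ _ x (Fin.succ_ne_zero _)]
  -- The Dirac mass sets the first particle equal to `x`, so the outer integral over `x` takes the
  -- place of the integral over `ξ 0`.
  rw [lintegral_dirac' _ hc'.lintegral_prod_right']
  rw [lintegral_pi_withDensity μ hg m hc]
  simp [he]

end Pi

/-! ### Sampling from finite weights -/

section Catprob

variable {ι : Type*} [Fintype ι]

theorem catProb_le_one [Nonempty ι] (w : ι → ℝ≥0∞) (k : ι) : catProb w k ≤ 1 :=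
  (Finset.single_le_sum (f := catProb w) (fun _ _ => zero_le) (Finset.mem_univ k)).trans_eq
    (sum_catProb w)

/-- Neither the total weight nor the uniform default depends on the labels. -/
theorem catProb_comp_equiv (σ : ι ≃ ι) (w : ι → ℝ≥0∞) (k : ι) :
    catProb (fun i => w (σ i)) k = catProb w (σ k) := by
  unfold catProb
  rw [σ.sum_comp w]

theorem catProb_of_ne {w : ι → ℝ≥0∞} (h0 : ∑ j, w j ≠ 0) (ht : ∑ j, w j ≠ ∞) (k : ι) :
    catProb w k = w k / ∑ j, w j := by
  simp [catProb, h0, ht]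

end Catprob

theorem lintegral_pi_fin_one {α : Type*} [MeasurableSpace α] (μ : Measure α) [SigmaFinite μ]
    (f : (Fin 1 → α) → ℝ≥0∞) :
    ∫⁻ ξ, f ξ ∂Measure.pi (fun _ => μ) = ∫⁻ x, f (fun _ => x) ∂μ :=
  ((measurePreserving_funUnique μ (Fin 1)).symm.lintegral_comp_emb
    (MeasurableEquiv.measurableEmbedding _) f).symm

theorem densityKernel_apply {α β : Type*} [MeasurableSpace α] [MeasurableSpace β]
    (ref : Measure β) [SigmaFinite ref] {d : α → β → ℝ≥0}
    (hd : Measurable (Function.uncurry d)) (a : α) :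
    densityKernel ref d a = ref.withDensity fun b => (d a b : ℝ≥0∞) := by
  have hd' : Measurable (Function.uncurry fun a b => (d a b : ℝ≥0∞)) :=
    measurable_coe_nnreal_ennreal.comp hd
  rw [densityKernel, Kernel.withDensity_apply _ hd', Kernel.const_apply]

/-! ### The joint density of the retained path and the particles -/

section Model

variable {Θ Z Y : Type*} [MeasurableSpace Θ] [MeasurableSpace Z]
  {ν : Measure Θ} {lam : Measure Z} {S : StateSpaceModel Θ Z Y ν lam} {y : ℕ → Y}

namespace ParticleProposal

variable (A : ParticleProposal S y)

/-- The density of a particle at time `t + 1` given the particles `ξ` at time `t`. -/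
def resampleDensity {M : ℕ} (t : ℕ) (θ : Θ) (ξ : Fin M → Z) (x : Z) : ℝ≥0∞ :=
  ∑ a, catProb (fun j => (A.w t θ (ξ j) : ℝ≥0∞)) a * A.H t θ (ξ a) x

/-- The joint density of the particles other than the retained ones. -/
def csmcDensity {M n : ℕ} [NeZero M] (θ : Θ) (ζ : Particles Z n M) : ℝ≥0∞ :=
  (∏ i ∈ Finset.univ.erase 0, (A.h θ (ζ 0 i) : ℝ≥0∞)) *
    ∏ t : Fin n, ∏ i ∈ Finset.univ.erase 0, A.resampleDensity t θ (ζ t.castSucc) (ζ t.succ i)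

theorem measurable_resampleDensity {M : ℕ} (t : ℕ) (θ : Θ) :
    Measurable fun p : (Fin M → Z) × Z => A.resampleDensity t θ p.1 p.2 := by
  refine Finset.measurable_fun_sum _ fun a _ => (measurable_catProb (fun j => ?_) a).mul ?_
  · exact ((A.measurable_w t).comp (f := fun p : (Fin M → Z) × Z => (θ, p.1 j))
      (by fun_prop)).coe_nnreal_ennreal
  · exact ((A.measurable_H t).comp (f := fun p : (Fin M → Z) × Z => (θ, p.1 a, p.2))
      (by fun_prop)).coe_nnreal_ennreal

theorem measurable_csmcDensity {M n : ℕ} [NeZero M] (θ : Θ) :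
    Measurable (A.csmcDensity (n := n) (M := M) θ) := by
  refine Measurable.mul ?_ ?_
  · exact Finset.measurable_fun_prod _ fun i _ => (A.measurable_h.comp
      (f := fun ζ : Particles Z n M => (θ, ζ 0 i)) (by fun_prop)).coe_nnreal_ennreal
  · exact Finset.measurable_fun_prod _ fun t _ => Finset.measurable_fun_prod _ fun i _ =>
      (A.measurable_resampleDensity t θ).comp
        (f := fun ζ : Particles Z n M => (ζ t.castSucc, ζ t.succ i)) (by fun_prop)

theorem csmcDensity_snoc {M n : ℕ} [NeZero M] (θ : Θ) (ζ : Particles Z n M) (ξ : Fin M → Z) :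
    A.csmcDensity θ (Fin.snoc ζ ξ : Particles Z (n + 1) M) = A.csmcDensity θ ζ *
      ∏ i ∈ Finset.univ.erase 0, A.resampleDensity n θ (ζ (Fin.last n)) (ξ i) := by
  have h0 : (Fin.snoc ζ ξ : Particles Z (n + 1) M) 0 = ζ 0 :=
    Fin.snoc_castSucc (α := fun _ => Fin M → Z) ξ ζ 0
  simp [csmcDensity, Fin.prod_univ_castSucc, h0, ← Fin.castSucc_succ, mul_assoc]

theorem measurable_generationIntegrand (M n : ℕ) [NeZero M] (θ : Θ)
    {F : Path Z (n + 1) → Particles Z (n + 1) M → ℝ≥0∞} (hF : Measurable (Function.uncurry F)) :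
    Measurable fun p : (Path Z n × Particles Z n M) × (Fin M → Z) =>
      (∏ i ∈ Finset.univ.erase 0, A.resampleDensity n θ (p.1.2 (Fin.last n)) (p.2 i)) *
        F (Fin.snoc p.1.1 (p.2 0)) (Fin.snoc p.1.2 p.2) := by
  have hF3 : Measurable fun p : (Path Z n × Z) × (Particles Z n M × (Fin M → Z)) =>
      F (Fin.snoc p.1.1 p.1.2) (Fin.snoc p.2.1 p.2.2) :=
    hF.comp (((measurable_snoc (n + 1)).comp measurable_fst).prodMk
      ((measurable_snoc (n + 1)).comp measurable_snd))
  refine Measurable.mul (Finset.measurable_fun_prod _ fun i _ => ?_) ?_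
  · exact (A.measurable_resampleDensity n θ).comp
      (f := fun p : (Path Z n × Particles Z n M) × (Fin M → Z) =>
        (p.1.2 (Fin.last n), p.2 i)) (by fun_prop)
  · exact (hF3.comp (show Measurable fun p : (Path Z n × Particles Z n M) × (Fin M → Z) =>
      ((p.1.1, p.2 0), (p.1.2, p.2)) by fun_prop) :)

section Integral

variable [SigmaFinite lam]

theorem initialMove_apply (p : Θ × Z) :
    A.initialMove p = lam.withDensity fun x => (A.h p.1 x : ℝ≥0∞) :=
  densityKernel_apply _
    (d := fun (p : Θ × Z) z => A.h p.1 z)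
    (A.measurable_h.comp (f := fun b : (Θ × Z) × Z => (b.1.1, b.2)) (by fun_prop)) p

/-- The ancestor index is summed out, so the law of a new particle is a symmetric function of the
previous generation. -/
theorem resampleMove_apply (M : ℕ) [NeZero M] (t : ℕ) (p : Θ × Z × (Fin M → Z)) :
    A.resampleMove M t p = lam.withDensity (A.resampleDensity t p.1 p.2.2) := by
  have hH (a : Fin M) : Measurable (Function.uncurry
      fun (p : Θ × Z × (Fin M → Z)) z' => A.H t p.1 (p.2.2 a) z') :=
    (A.measurable_H t).comp (f := fun b : (Θ × Z × (Fin M → Z)) × Z =>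
        (b.1.1, b.1.2.2 a, b.2)) (by fun_prop)
  change ∑ a, _ • densityKernel lam
    (fun (p : Θ × Z × (Fin M → Z)) z' => A.H t p.1 (p.2.2 a) z') p = _
  simp_rw [densityKernel_apply lam (hH _)]
  ext s hs
  simp only [Measure.coe_finsetSum, Finset.sum_apply, Measure.smul_apply, smul_eq_mul,
    withDensity_apply _ hs, resampleDensity]
  have hm (a : Fin M) : Measurable fun x => (A.H t p.1 (p.2.2 a) x : ℝ≥0∞) :=
    ((hH a).comp (measurable_prodMk_left (x := p))).coe_nnreal_ennreal
  rw [lintegral_finsetSum _ fun a _ => (hm a).const_mul _]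
  exact Finset.sum_congr rfl fun a _ => (lintegral_const_mul _ (hm a)).symm

theorem lintegral_retainOr {M : ℕ} [NeZero M] {β : Type*} [MeasurableSpace β]
    (κ : Kernel (Θ × Z × β) Z) [IsMarkovKernel κ] (θ : Θ) (b : β) {g : Z → ℝ≥0∞}
    (hg : Measurable g) (hκ : ∀ x, κ (θ, x, b) = lam.withDensity g)
    {F : Z → (Fin M → Z) → ℝ≥0∞} (hF : Measurable (Function.uncurry F)) :
    ∫⁻ x, ∫⁻ ξ, F x ξ ∂piKernel (retainOr M κ) (θ, x, b) ∂lam =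
      ∫⁻ ξ, (∏ i ∈ Finset.univ.erase 0, g (ξ i)) * F (ξ 0) ξ ∂Measure.pi (fun _ => lam) := by
  -- A point of `Z` is needed to read off from `hκ` that `g` is a probability density. If `Z` is
  -- empty, both integrals vanish.
  rcases isEmpty_or_nonempty Z with hZ | ⟨⟨x₀⟩⟩
  · have : IsEmpty (Fin M → Z) := ⟨fun ξ => hZ.elim (ξ 0)⟩
    simp [Measure.eq_zero_of_isEmpty]
  have : IsProbabilityMeasure (lam.withDensity g) := by
    rw [← hκ x₀]; infer_instance
  refine lintegral_pi_retain lam hg hF (fun i x => retainOr M κ i (θ, x, b)) (fun x => ?_)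
    fun i x hi => ?_
  · simp [retainOr, Kernel.deterministic_apply]
  · simp [retainOr, hi, hκ]

theorem lintegral_csmc_zero (M : ℕ) [NeZero M] (θ : Θ) {F : Path Z 0 → Particles Z 0 M → ℝ≥0∞}
    (hF : Measurable (Function.uncurry F)) :
    ∫⁻ z, ∫⁻ ζ, F z ζ ∂A.csmc M 0 (θ, z) ∂Measure.pi (fun _ => lam) =
      ∫⁻ ζ, A.csmcDensity θ ζ * F (fun t => ζ t 0) ζ
        ∂Measure.pi (fun _ => Measure.pi (fun _ => lam)) := by
  have hF' : Measurable fun p : Z × (Fin M → Z) => F (fun _ => p.1) fun _ => p.2 :=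
    hF.comp (f := fun p : Z × (Fin M → Z) => ((fun _ => p.1, fun _ => p.2) :
      Path Z 0 × Particles Z 0 M)) (by fun_prop)
  have hl (x : Z) : ∫⁻ ζ, F (fun _ => x) ζ ∂A.csmc M 0 (θ, fun _ => x) =
      ∫⁻ ξ, F (fun _ => x) (fun _ => ξ) ∂piKernel (retainOr M (A.initialMove.comap
        (fun p : Θ × Z × Unit => (p.1, p.2.1)) (by fun_prop))) (θ, x, ()) := by
    have hFx : Measurable (F fun _ => x) := hF.comp measurable_prodMk_left
    rw [csmc, Kernel.lintegral_map _ (f := fun (ξ : Fin M → Z) (_ : Fin 1) => ξ)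
      (by fun_prop) _ hFx,
      Kernel.lintegral_comap]
  rw [lintegral_pi_fin_one, lintegral_pi_fin_one]
  simp_rw [hl]
  rw [lintegral_retainOr (lam := lam) _ θ () (g := fun x => (A.h θ x : ℝ≥0∞))
    (A.measurable_h.comp measurable_prodMk_left).coe_nnreal_ennreal
    (fun x => by rw [Kernel.comap_apply, initialMove_apply])
    (F := fun x ξ => F (fun _ => x) fun _ => ξ) hF']
  simp [csmcDensity]

theorem measurable_lintegral_csmc (M : ℕ) {n : ℕ} [NeZero M] (θ : Θ)
    {F : Path Z n → Particles Z n M → ℝ≥0∞} (hF : Measurable (Function.uncurry F)) :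
    Measurable fun z => ∫⁻ ζ, F z ζ ∂A.csmc M n (θ, z) :=
  Measurable.lintegral_kernel_prod_right'
    (κ := (A.csmc M n).comap (fun z => (θ, z)) measurable_prodMk_left) hF

theorem lintegral_csmc_snoc (M n : ℕ) [NeZero M] (θ : Θ)
    {F : Path Z (n + 1) → Particles Z (n + 1) M → ℝ≥0∞} (hF : Measurable (Function.uncurry F))
    (z : Path Z n) (x : Z) :
    ∫⁻ ζ, F (Fin.snoc z x) ζ ∂A.csmc M (n + 1) (θ, Fin.snoc z x) =
      ∫⁻ ζ, ∫⁻ ξ, F (Fin.snoc z x) (Fin.snoc ζ ξ) ∂piKernel (retainOr M (A.resampleMove M n))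
          (θ, x, ζ (Fin.last n)) ∂A.csmc M n (θ, z) := by
  have hFx : Measurable (F (Fin.snoc z x)) := hF.comp measurable_prodMk_left
  have hFs : Measurable fun a : (Fin (n + 1) → Fin M → Z) × (Fin M → Z) =>
      F (Fin.snoc z x) (Fin.snoc a.1 a.2) := hFx.comp (measurable_snoc (n + 1))
  rw [csmc, Kernel.lintegral_map _ (measurable_snoc (n + 1)) _ hFx,
    Kernel.lintegral_compProd _ _ _ hFs, Kernel.lintegral_comap]
  simp only [Kernel.lintegral_comap, Fin.init_snoc, Fin.snoc_last]

theorem lintegral_csmc_succ (M n : ℕ) [NeZero M] (θ : Θ)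
    {F : Path Z (n + 1) → Particles Z (n + 1) M → ℝ≥0∞} (hF : Measurable (Function.uncurry F)) :
    ∫⁻ z, ∫⁻ ζ, F z ζ ∂A.csmc M (n + 1) (θ, z) ∂Measure.pi (fun _ => lam) =
      ∫⁻ z, ∫⁻ ζ, ∫⁻ ξ,
        (∏ i ∈ Finset.univ.erase 0, A.resampleDensity n θ (ζ (Fin.last n)) (ξ i)) *
          F (Fin.snoc z (ξ 0)) (Fin.snoc ζ ξ)
        ∂Measure.pi (fun _ => lam) ∂A.csmc M n (θ, z) ∂Measure.pi (fun _ => lam) := by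
  have hl (z : Path Z n) (x : Z) := A.lintegral_csmc_snoc M n θ hF z x
  have hF3 : Measurable fun p : (Path Z n × Z) × (Particles Z n M × (Fin M → Z)) =>
      F (Fin.snoc p.1.1 p.1.2) (Fin.snoc p.2.1 p.2.2) :=
    hF.comp (((measurable_snoc (n + 1)).comp measurable_fst).prodMk
      ((measurable_snoc (n + 1)).comp measurable_snd))
  have hswap (z : Path Z n) : Measurable fun p : Z × Particles Z n M =>
      ∫⁻ ξ, F (Fin.snoc z p.1) (Fin.snoc p.2 ξ) ∂piKernel (retainOr M (A.resampleMove M n))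
        (θ, p.1, p.2 (Fin.last n)) :=
    (Measurable.lintegral_kernel_prod_right'
      (κ := (piKernel (retainOr M (A.resampleMove M n))).comap
        (fun p : Z × Particles Z n M => (θ, p.1, p.2 (Fin.last n))) (by fun_prop))
      (hF3.comp (show Measurable fun p : (Z × Particles Z n M) × (Fin M → Z) =>
        ((z, p.1.1), (p.1.2, p.2)) by fun_prop)) :)
  have hout : Measurable fun z => ∫⁻ ζ, F z ζ ∂A.csmc M (n + 1) (θ, z) :=
    A.measurable_lintegral_csmc M θ hF
  have hg (ξ : Fin M → Z) : Measurable (A.resampleDensity n θ ξ) :=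
    ((A.measurable_resampleDensity n θ).comp (measurable_prodMk_left (x := ξ)) :)
  have hstep (z : Path Z n) (ζ : Particles Z n M) :
      ∫⁻ x, ∫⁻ ξ, F (Fin.snoc z x) (Fin.snoc ζ ξ) ∂piKernel (retainOr M (A.resampleMove M n))
        (θ, x, ζ (Fin.last n)) ∂lam =
      ∫⁻ ξ, (∏ i ∈ Finset.univ.erase 0, A.resampleDensity n θ (ζ (Fin.last n)) (ξ i)) *
        F (Fin.snoc z (ξ 0)) (Fin.snoc ζ ξ) ∂Measure.pi (fun _ => lam) :=
    lintegral_retainOr (A.resampleMove M n) θ (ζ (Fin.last n)) (hg (ζ (Fin.last n)))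
      (fun x => A.resampleMove_apply M n _)
      (F := fun x ξ => F (Fin.snoc z x) (Fin.snoc ζ ξ))
      (hF3.comp (show Measurable fun p : Z × (Fin M → Z) => ((z, p.1), (ζ, p.2)) by fun_prop) :)
  rw [lintegral_pi_snoc lam hout]
  refine lintegral_congr fun z => ?_
  simp_rw [hl]
  -- The earlier generations do not depend on the newest retained state `x`, so `x` can be
  -- integrated before them.
  rw [lintegral_lintegral_swap (hswap z).aemeasurable]
  exact lintegral_congr fun ζ => hstep z ζ

/-- The retained path, drawn from the reference measure, and the particles of the conditional
SMC algorithm have joint density `csmcDensity`. -/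
theorem lintegral_csmc (M n : ℕ) [NeZero M] (θ : Θ)
    {F : Path Z n → Particles Z n M → ℝ≥0∞} (hF : Measurable (Function.uncurry F)) :
    ∫⁻ z, ∫⁻ ζ, F z ζ ∂A.csmc M n (θ, z) ∂Measure.pi (fun _ => lam) =
      ∫⁻ ζ, A.csmcDensity θ ζ * F (fun t => ζ t 0) ζ
        ∂Measure.pi (fun _ => Measure.pi (fun _ => lam)) := by
  induction n with
  | zero => exact A.lintegral_csmc_zero M θ hF
  | succ n ih =>
    have hG := A.measurable_generationIntegrand M n θ hF
    have hR : Measurable fun ζ : Particles Z (n + 1) M =>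
        A.csmcDensity θ ζ * F (fun t => ζ t 0) ζ :=
      (A.measurable_csmcDensity θ).mul (hF.comp
        (f := fun ζ : Particles Z (n + 1) M => ((fun t => ζ t 0 : Path Z (n + 1)), ζ))
        (by fun_prop))
    -- The last generation is absorbed into the test function, to which the induction hypothesis
    -- then applies.
    rw [A.lintegral_csmc_succ M n θ hF, ih (F := fun z ζ => ∫⁻ ξ, (∏ i ∈ Finset.univ.erase 0,
      A.resampleDensity n θ (ζ (Fin.last n)) (ξ i)) * F (Fin.snoc z (ξ 0)) (Fin.snoc ζ ξ)
      ∂Measure.pi (fun _ => lam)) hG.lintegral_prod_right', lintegral_pi_snoc _ hR]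
    refine lintegral_congr fun ζ => ?_
    have hGζ : Measurable fun ξ : Fin M → Z =>
        (∏ i ∈ Finset.univ.erase 0, A.resampleDensity n θ (ζ (Fin.last n)) (ξ i)) *
          F (Fin.snoc (fun t => ζ t 0) (ξ 0)) (Fin.snoc ζ ξ) :=
      (hG.comp (measurable_prodMk_left (x := ((fun t => ζ t 0), ζ))) :)
    rw [← lintegral_const_mul _ hGζ]
    refine lintegral_congr fun ξ => ?_
    have hz : (fun t => (Fin.snoc ζ ξ : Particles Z (n + 1) M) t 0) =
        Fin.snoc (fun t => ζ t 0) (ξ 0) := by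
      ext t
      cases t using Fin.lastCases <;> simp
    rw [hz, A.csmcDensity_snoc]
    simp [mul_assoc]

end Integral

end ParticleProposal

end Model

/-! ### Relabelling the particles within each generation -/

section Relabel

variable {Z : Type*} {n M : ℕ}

/-- Relabel the particles of each generation. -/
def relabel (σ : Fin (n + 1) → Equiv.Perm (Fin M)) (ζ : Particles Z n M) : Particles Z n M :=
  fun t i => ζ t (σ t i)

/-- Exchange the first particle and particle `k t` in each generation. -/
abbrev swapPaths [NeZero M] (k : Fin (n + 1) → Fin M) : Particles Z n M → Particles Z n M :=
  relabel fun t => Equiv.swap 0 (k t)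

theorem swapPaths_zero [NeZero M] (k : Fin (n + 1) → Fin M) (ζ : Particles Z n M) :
    (fun t => swapPaths k ζ t 0) = select ζ k := by
  ext t; simp [relabel, select]

theorem select_swapPaths [NeZero M] (k : Fin (n + 1) → Fin M) (ζ : Particles Z n M) :
    select (swapPaths k ζ) k = fun t => ζ t 0 := by
  ext t; simp [relabel, select]

theorem measurePreserving_relabel [MeasurableSpace Z] (lam : Measure Z) [SigmaFinite lam]
    (σ : Fin (n + 1) → Equiv.Perm (Fin M)) :
    MeasurePreserving (relabel (Z := Z) σ)
      (Measure.pi fun _ => Measure.pi fun _ => lam) (Measure.pi fun _ => Measure.pi fun _ => lam) := by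
  refine measurePreserving_pi (fun _ => Measure.pi fun _ => lam) (fun _ => Measure.pi fun _ => lam)
    (f := fun t ξ i => ξ (σ t i)) fun t => ?_
  -- The inverse of this equivalence is `ξ ↦ ξ ∘ σ t`, and all factors of the product measure are
  -- equal.
  have h := (measurePreserving_piCongrLeft (fun _ : Fin M => lam) (σ t)).symm
  exact h

end Relabel

/-! ### Backward sampling and the exchange of paths -/

section Model

variable {Θ Z Y : Type*} [MeasurableSpace Θ] [MeasurableSpace Z]
  {ν : Measure Θ} {lam : Measure Z} {S : StateSpaceModel Θ Z Y ν lam} {y : ℕ → Y}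

namespace StateSpaceModel

theorem jointDensity_succ (S : StateSpaceModel Θ Z Y ν lam) (y : ℕ → Y) {n : ℕ} (θ : Θ)
    (z : Path Z (n + 1)) :
    S.jointDensity y θ z = S.jointDensity y θ (Fin.init z : Path Z n) *
      (S.f θ (z (Fin.last n).castSucc) (z (Fin.last (n + 1))) *
        S.g θ (z (Fin.last (n + 1))) (y (n + 1))) := by
  simp only [jointDensity, Fin.prod_univ_castSucc (n := n), Fin.prod_univ_castSucc (n := n + 1),
    Fin.init, Fin.succ_last, ← Fin.castSucc_succ, Fin.castSucc_zero, Fin.val_last,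
    Fin.val_castSucc]
  ring

end StateSpaceModel

namespace ParticleProposal

variable (A : ParticleProposal S y) {n M : ℕ}

theorem backwardProb_relabel (σ : Fin (n + 1) → Equiv.Perm (Fin M)) (θ : Θ)
    (ζ : Particles Z n M) (l : Fin (n + 1) → Fin M) :
    A.backwardProb θ (relabel σ ζ) l = A.backwardProb θ ζ fun t => σ t (l t) := by
  simp only [backwardProb, relabel]
  congr 1
  · exact catProb_comp_equiv (σ (Fin.last n)) (fun i => (A.w n θ (ζ (Fin.last n) i) : ℝ≥0∞)) _
  · exact Finset.prod_congr rfl fun t _ => catProb_comp_equiv (σ t.castSucc) (fun i =>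
      (A.w t θ (ζ t.castSucc i) * S.f θ (ζ t.castSucc i)
        (ζ t.succ (σ t.succ (l t.succ))) : ℝ≥0)) _

/-- A relabelling only permutes the paths in the sum. Hence the two moves see the same estimator
although they retain different paths. -/
theorem allPathsRatio_relabel (Q : ParameterProposal Θ ν) (σ : Fin (n + 1) → Equiv.Perm (Fin M))
    (z : Path Z n) (ζ : Particles Z n M) (θ θ' θt : Θ) :
    A.allPathsRatio Q z (relabel σ ζ) θ θ' θt = A.allPathsRatio Q z ζ θ θ' θt := by
  simp only [allPathsRatio, backwardProb_relabel]
  exact (Equiv.piCongrRight σ).sum_comp fun l =>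
    A.backwardProb θt ζ l * S.pathRatio y Q z (select ζ l) θ θ' θt

theorem backwardProb_le_one [NeZero M] (θ : Θ) (ζ : Particles Z n M) (k : Fin (n + 1) → Fin M) :
    A.backwardProb θ ζ k ≤ 1 :=
  (Finset.single_le_sum (f := A.backwardProb θ ζ) (fun _ _ => zero_le)
    (Finset.mem_univ k)).trans_eq (A.sum_backwardProb θ ζ)

/-- The density of a particle at time `t` given the particles at the previous times. -/
def particleDensity (θ : Θ) (ζ : Particles Z n M) (t : Fin (n + 1)) : Z → ℝ≥0∞ :=
  Fin.cases (fun x => (A.h θ x : ℝ≥0∞)) (fun s => A.resampleDensity s θ (ζ s.castSucc)) t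

/-- A relabelling only permutes the ancestors in the mixture. -/
theorem particleDensity_relabel (σ : Fin (n + 1) → Equiv.Perm (Fin M)) (θ : Θ)
    (ζ : Particles Z n M) (t : Fin (n + 1)) :
    A.particleDensity θ (relabel σ ζ) t = A.particleDensity θ ζ t := by
  cases t using Fin.cases with
  | zero => rfl
  | succ s =>
    ext x
    simp only [particleDensity, Fin.cases_succ, resampleDensity, relabel]
    rw [← Equiv.sum_comp (σ s.castSucc) fun a => catProb (fun j => (A.w s θ (ζ s.castSucc j) : ℝ≥0∞)) a *
      A.H s θ (ζ s.castSucc a) x]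
    exact Finset.sum_congr rfl fun a _ => by
      rw [catProb_comp_equiv (σ s.castSucc) (fun i => (A.w s θ (ζ s.castSucc i) : ℝ≥0∞))]

theorem csmcDensity_eq_prod [NeZero M] (θ : Θ) (ζ : Particles Z n M) :
    A.csmcDensity θ ζ =
      ∏ t, ∏ i ∈ Finset.univ.erase 0, A.particleDensity θ ζ t (ζ t i) := by
  rw [Fin.prod_univ_succ]
  rfl

theorem particleDensity_ne_top [NeZero M] (θ : Θ) (ζ : Particles Z n M) (t : Fin (n + 1)) (x : Z) :
    A.particleDensity θ ζ t x ≠ ∞ := by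
  cases t using Fin.cases with
  | zero => exact ENNReal.coe_ne_top
  | succ s =>
    change ∑ a : Fin M, _ ≠ ∞
    refine ENNReal.sum_ne_top.2 fun a _ => ENNReal.mul_ne_top ?_ ENNReal.coe_ne_top
    exact ((catProb_le_one _ a).trans_lt ENNReal.one_lt_top).ne

/-- The total weight of the particles at time `t`. -/
def weightSum (θ : Θ) (ζ : Particles Z n M) (t : Fin (n + 1)) : ℝ≥0∞ :=
  ∑ j, (A.w t θ (ζ t j) : ℝ≥0∞)

theorem weightSum_ne_top (θ : Θ) (ζ : Particles Z n M) (t : Fin (n + 1)) :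
    A.weightSum θ ζ t ≠ ∞ := ENNReal.sum_ne_top.2 fun _ _ => ENNReal.coe_ne_top

theorem weightSum_relabel (σ : Fin (n + 1) → Equiv.Perm (Fin M)) (θ : Θ) (ζ : Particles Z n M)
    (t : Fin (n + 1)) : A.weightSum θ (relabel σ ζ) t = A.weightSum θ ζ t :=
  Equiv.sum_comp (σ t) fun j => (A.w t θ (ζ t j) : ℝ≥0∞)

/-- One backward-sampling step cancels the mixture over the ancestors of the chosen particle. -/
theorem catProb_mul_resampleDensity (t : ℕ) (θ : Θ) (ξ : Fin M → Z) (x : Z) (i : Fin M)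
    (h0 : ∑ j, (A.w t θ (ξ j) : ℝ≥0∞) ≠ 0) :
    catProb (fun j => (A.w t θ (ξ j) * S.f θ (ξ j) x : ℝ≥0)) i *
        (A.resampleDensity t θ ξ x * A.w (t + 1) θ x) =
      A.w t θ (ξ i) * (S.f θ (ξ i) x * S.g θ x (y (t + 1))) *
        (∑ j, (A.w t θ (ξ j) : ℝ≥0∞))⁻¹ := by
  set s := ∑ j, (A.w t θ (ξ j) : ℝ≥0∞)
  have hs : s ≠ ∞ := ENNReal.sum_ne_top.2 fun _ _ => ENNReal.coe_ne_top
  set D := ∑ j, ((A.w t θ (ξ j) * S.f θ (ξ j) x : ℝ≥0) : ℝ≥0∞) with hD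
  have hDt : D ≠ ∞ := ENNReal.sum_ne_top.2 fun _ _ => ENNReal.coe_ne_top
  -- By `w H = f g`, the weighted mixture over ancestors becomes `D`, the normalising sum of the
  -- backward weights.
  have h1 : A.resampleDensity t θ ξ x * A.w (t + 1) θ x =
      D * (S.g θ x (y (t + 1)) * s⁻¹) := by
    rw [resampleDensity, hD, Finset.sum_mul, Finset.sum_mul]
    refine Finset.sum_congr rfl fun a _ => ?_
    have hw : (A.H t θ (ξ a) x : ℝ≥0∞) * A.w (t + 1) θ x =
        S.f θ (ξ a) x * S.g θ x (y (t + 1)) := by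
      rw [mul_comm]; exact_mod_cast A.w_succ t θ (ξ a) x
    rw [catProb_of_ne h0 hs, mul_assoc, hw, div_eq_mul_inv, ENNReal.coe_mul]
    ring
  rw [h1, ← mul_assoc]
  -- If `D = 0`, the backward step falls back on the uniform default, but both sides vanish.
  by_cases hD0 : D = 0
  · have hi : ((A.w t θ (ξ i) * S.f θ (ξ i) x : ℝ≥0) : ℝ≥0∞) = 0 :=
      Finset.sum_eq_zero_iff.1 hD0 i (Finset.mem_univ i)
    rw [hD0, mul_zero, zero_mul, ← mul_assoc, ← ENNReal.coe_mul, hi, zero_mul, zero_mul]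
  · rw [catProb_of_ne hD0 hDt, ENNReal.div_mul_cancel hD0 hDt, ENNReal.coe_mul]
    ring

/-- Induction on the horizon, one use of `catProb_mul_resampleDensity` per step. The unnormalised
weight at the final time stands where `backwardProb` has a probability: it is the factor that the
next backward step produces. -/
theorem backwardProb_mul_prod_aux (θ : Θ) : ∀ (n : ℕ) (ζ : Particles Z n M)
    (k : Fin (n + 1) → Fin M), (∀ t : Fin n, A.weightSum θ ζ t.castSucc ≠ 0) →
    (∏ t : Fin n, catProb (fun i => (A.w t θ (ζ t.castSucc i) *
        S.f θ (ζ t.castSucc i) (ζ t.succ (k t.succ)) : ℝ≥0)) (k t.castSucc)) *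
      (∏ t, A.particleDensity θ ζ t (ζ t (k t))) * A.w n θ (ζ (Fin.last n) (k (Fin.last n))) =
    S.jointDensity y θ (select ζ k) * ∏ t : Fin n, (A.weightSum θ ζ t.castSucc)⁻¹
  | 0, ζ, k, _ => by
    have h0 : (A.w 0 θ (ζ 0 (k 0)) : ℝ≥0∞) * A.h θ (ζ 0 (k 0)) =
        S.μ θ (ζ 0 (k 0)) * S.g θ (ζ 0 (k 0)) (y 0) := by
      exact_mod_cast A.w_zero θ (ζ 0 (k 0))
    simpa [particleDensity, StateSpaceModel.jointDensity, select, mul_comm] using h0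
  | n + 1, ζ, k, h => by
    have ih := backwardProb_mul_prod_aux θ n (Fin.init ζ) (Fin.init k) fun t => h t.castSucc
    have hstep := A.catProb_mul_resampleDensity n θ (ζ (Fin.last n).castSucc)
      (ζ (Fin.last (n + 1)) (k (Fin.last (n + 1)))) (k (Fin.last n).castSucc) (h (Fin.last n))
    have hpd (t : Fin (n + 1)) : A.particleDensity θ ζ t.castSucc =
        A.particleDensity θ (Fin.init ζ : Particles Z n M) t := by
      cases t using Fin.cases <;> rfl
    have hpl : A.particleDensity θ ζ (Fin.last (n + 1)) =
        A.resampleDensity n θ (ζ (Fin.last n).castSucc) := rfl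
    rw [StateSpaceModel.jointDensity_succ, Fin.prod_univ_castSucc, Fin.prod_univ_castSucc,
      Fin.prod_univ_castSucc (n := n) (f := fun t => (A.weightSum θ ζ t.castSucc)⁻¹)]
    simp only [hpd, hpl]
    rw [ENNReal.coe_mul, ENNReal.coe_mul]
    -- Here `h₁` is the induction hypothesis and `h₂` the new backward step; they share the weight
    -- `w` of the selected particle at time `n`.
    have alg {P c G r w₁ w f g s p Q : ℝ≥0∞} (h₁ : P * G * w = p * Q)
        (h₂ : c * (r * w₁) = w * (f * g) * s) :
        P * c * (G * r) * w₁ = p * (f * g) * (Q * s) := by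
      calc _ = P * G * (c * (r * w₁)) := by ring
        _ = P * G * w * (f * g * s) := by rw [h₂]; ring
        _ = _ := by rw [h₁]; ring
    exact alg ih hstep

/-- The key identity: on the right, the indices `k` enter only through the joint density of the
selected path. -/
theorem backwardProb_mul_prod (θ : Θ) (ζ : Particles Z n M) (k : Fin (n + 1) → Fin M)
    (h : ∀ t, A.weightSum θ ζ t ≠ 0) :
    A.backwardProb θ ζ k * ∏ t, A.particleDensity θ ζ t (ζ t (k t)) =
      S.jointDensity y θ (select ζ k) * ∏ t, (A.weightSum θ ζ t)⁻¹ := by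
  have hm := A.backwardProb_mul_prod_aux θ n ζ k fun t => h _
  have hn : catProb (fun i => (A.w n θ (ζ (Fin.last n) i) : ℝ≥0∞)) (k (Fin.last n)) =
      A.w n θ (ζ (Fin.last n) (k (Fin.last n))) * (A.weightSum θ ζ (Fin.last n))⁻¹ := by
    exact (catProb_of_ne (w := fun i => (A.w n θ (ζ (Fin.last n) i) : ℝ≥0∞)) (h (Fin.last n))
      (A.weightSum_ne_top θ ζ (Fin.last n)) _).trans (div_eq_mul_inv _ _)
  rw [Fin.prod_univ_castSucc (f := fun t => (A.weightSum θ ζ t)⁻¹), ← mul_assoc, ← hm,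
    backwardProb, hn]
  ring

/-! ### Positivity along a path of positive joint density -/

section Positive

variable {θ : Θ} {ζ : Particles Z n M} {k : Fin (n + 1) → Fin M}

theorem factors_ne_zero {z : Path Z n} (h : S.jointDensity y θ z ≠ 0) :
    S.μ θ (z 0) ≠ 0 ∧ (∀ t : Fin n, S.f θ (z t.castSucc) (z t.succ) ≠ 0) ∧
      ∀ t : Fin (n + 1), S.g θ (z t) (y t) ≠ 0 := by
  rw [StateSpaceModel.jointDensity, mul_ne_zero_iff, mul_ne_zero_iff, Finset.prod_ne_zero_iff,
    Finset.prod_ne_zero_iff] at h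
  exact ⟨h.1.1, fun t => h.1.2 t (Finset.mem_univ t), fun t => h.2 t (Finset.mem_univ t)⟩

theorem w_mul_h_ne_zero {z : Path Z n} (h : S.jointDensity y θ z ≠ 0) :
    A.w 0 θ (z 0) ≠ 0 ∧ A.h θ (z 0) ≠ 0 := by
  obtain ⟨h₁, -, h₃⟩ := factors_ne_zero h
  rw [← mul_ne_zero_iff, A.w_zero]
  exact mul_ne_zero h₁ (h₃ 0)

theorem w_mul_H_ne_zero {z : Path Z n} (h : S.jointDensity y θ z ≠ 0) (t : Fin n) :
    A.w (t + 1) θ (z t.succ) ≠ 0 ∧ A.H t θ (z t.castSucc) (z t.succ) ≠ 0 := by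
  obtain ⟨-, h₂, h₃⟩ := factors_ne_zero h
  rw [← mul_ne_zero_iff, A.w_succ]
  exact mul_ne_zero (h₂ t) (h₃ t.succ)

theorem w_ne_zero {z : Path Z n} (h : S.jointDensity y θ z ≠ 0) (t : Fin (n + 1)) :
    A.w t θ (z t) ≠ 0 := by
  cases t using Fin.cases with
  | zero => exact (A.w_mul_h_ne_zero h).1
  | succ s => exact (A.w_mul_H_ne_zero h s).1

theorem weightSum_ne_zero (h : S.jointDensity y θ (select ζ k) ≠ 0) (t : Fin (n + 1)) :
    A.weightSum θ ζ t ≠ 0 := fun h0 =>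
  A.w_ne_zero h t (by exact_mod_cast Finset.sum_eq_zero_iff.1 h0 (k t) (Finset.mem_univ _))

/-- The ancestor lying on the path itself already contributes a positive term to the mixture. -/
theorem particleDensity_ne_zero (h : S.jointDensity y θ (select ζ k) ≠ 0) (t : Fin (n + 1)) :
    A.particleDensity θ ζ t (ζ t (k t)) ≠ 0 := by
  cases t using Fin.cases with
  | zero => exact ENNReal.coe_ne_zero.2 (A.w_mul_h_ne_zero h).2
  | succ s =>
    intro h0
    have h0 : ∑ a : Fin M, catProb (fun j => (A.w s θ (ζ s.castSucc j) : ℝ≥0∞)) a *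
        A.H s θ (ζ s.castSucc a) (ζ s.succ (k s.succ)) = 0 := h0
    have h1 : catProb (fun j => (A.w s θ (ζ s.castSucc j) : ℝ≥0∞)) (k s.castSucc) *
        A.H s θ (ζ s.castSucc (k s.castSucc)) (ζ s.succ (k s.succ)) = 0 :=
      Finset.sum_eq_zero_iff.1 h0 (k s.castSucc) (Finset.mem_univ _)
    refine mul_ne_zero ?_ (ENNReal.coe_ne_zero.2 (A.w_mul_H_ne_zero h s).2) h1
    rw [catProb_of_ne (w := fun j => (A.w s θ (ζ s.castSucc j) : ℝ≥0∞))
      (A.weightSum_ne_zero h s.castSucc) (A.weightSum_ne_top θ ζ s.castSucc)]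
    exact ENNReal.div_ne_zero.2 ⟨ENNReal.coe_ne_zero.2 (A.w_ne_zero h s.castSucc),
      A.weightSum_ne_top θ ζ s.castSucc⟩

end Positive

variable [NeZero M]

/-- Restoring the missing factors of the retained particles gives a product over all particles, in
which no label is distinguished. -/
theorem csmcDensity_mul_prod (θ : Θ) (ζ : Particles Z n M) :
    A.csmcDensity θ ζ * ∏ t, A.particleDensity θ ζ t (ζ t 0) =
      ∏ t, ∏ i, A.particleDensity θ ζ t (ζ t i) := by
  rw [csmcDensity_eq_prod, ← Finset.prod_mul_distrib]
  exact Finset.prod_congr rfl fun t _ => Finset.prod_erase_mul _ _ (Finset.mem_univ _)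

/-- The joint density of the retained path, of the other particles and of the indices drawn by
backward sampling. -/
def backwardJoint (θ : Θ) (ζ : Particles Z n M) (k : Fin (n + 1) → Fin M) : ℝ≥0∞ :=
  S.jointDensity y θ (fun t => ζ t 0) * A.csmcDensity θ ζ * A.backwardProb θ ζ k

/-- Otherwise `backwardProb_mul_prod` yields a selected particle of zero forward density. It is not
the retained one, since the retained path has positive joint density, so its density is a factor of
`csmcDensity`, which vanishes. -/
theorem backwardJoint_eq_zero (θ : Θ) (ζ : Particles Z n M) (k : Fin (n + 1) → Fin M)
    (hk : S.jointDensity y θ (select ζ k) = 0) : A.backwardJoint θ ζ k = 0 := by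
  by_contra hne
  rw [backwardJoint, ← ne_eq, mul_ne_zero_iff, mul_ne_zero_iff] at hne
  obtain ⟨⟨h0, hc⟩, hb⟩ := hne
  have h0' : S.jointDensity y θ (select ζ fun _ => 0) ≠ 0 := ENNReal.coe_ne_zero.1 h0
  have hm := A.backwardProb_mul_prod θ ζ k (A.weightSum_ne_zero h0')
  rw [hk, ENNReal.coe_zero, zero_mul, mul_eq_zero, or_iff_right hb, Finset.prod_eq_zero_iff] at hm
  obtain ⟨t, -, ht⟩ := hm
  have hkt : k t ≠ 0 := fun hkt => A.particleDensity_ne_zero h0' t (by rwa [hkt] at ht)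
  refine hc ?_
  rw [csmcDensity_eq_prod]
  exact Finset.prod_eq_zero (Finset.mem_univ t)
    (Finset.prod_eq_zero (Finset.mem_erase.2 ⟨hkt, Finset.mem_univ _⟩) ht)

/-- With the forward densities of both paths as factors, the right-hand side is symmetric in the two
paths and otherwise ignores labels. -/
theorem backwardJoint_mul (θ : Θ) (ζ : Particles Z n M) (k : Fin (n + 1) → Fin M)
    (h : ∀ t, A.weightSum θ ζ t ≠ 0) :
    A.backwardJoint θ ζ k * ((∏ t, A.particleDensity θ ζ t (ζ t 0)) *
        ∏ t, A.particleDensity θ ζ t (ζ t (k t))) =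
      S.jointDensity y θ (fun t => ζ t 0) * S.jointDensity y θ (select ζ k) *
        ((∏ t, ∏ i, A.particleDensity θ ζ t (ζ t i)) * ∏ t, (A.weightSum θ ζ t)⁻¹) := by
  calc _ = S.jointDensity y θ (fun t => ζ t 0) *
        (A.csmcDensity θ ζ * ∏ t, A.particleDensity θ ζ t (ζ t 0)) *
        (A.backwardProb θ ζ k * ∏ t, A.particleDensity θ ζ t (ζ t (k t))) := by rw [backwardJoint]; ring
    _ = _ := by rw [A.csmcDensity_mul_prod, A.backwardProb_mul_prod θ ζ k h]; ring

/-- Exchanging the retained path with the path drawn by backward sampling leaves the joint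
density invariant. -/
theorem backwardJoint_swapPaths (θ : Θ) (ζ : Particles Z n M) (k : Fin (n + 1) → Fin M) :
    A.backwardJoint θ (swapPaths k ζ) k = A.backwardJoint θ ζ k := by
  -- If either path has zero joint density, both sides vanish: on one side it is the retained path,
  -- on the other the selected one.
  by_cases h0 : S.jointDensity y θ (fun t => ζ t 0) = 0
  · rw [A.backwardJoint_eq_zero θ (swapPaths k ζ) k (by rw [select_swapPaths, h0]),
      backwardJoint, h0, ENNReal.coe_zero, zero_mul, zero_mul]
  by_cases hk : S.jointDensity y θ (select ζ k) = 0
  · rw [A.backwardJoint_eq_zero θ ζ k hk, backwardJoint, swapPaths_zero, hk, ENNReal.coe_zero,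
      zero_mul, zero_mul]
  have hw := A.weightSum_ne_zero hk
  have h1 := A.backwardJoint_mul θ ζ k hw
  have h2 := A.backwardJoint_mul θ (swapPaths k ζ) k fun t => by
    rw [weightSum_relabel]; exact hw t
  have hE : ∏ t, ∏ i, A.particleDensity θ ζ t (swapPaths k ζ t i) =
      ∏ t, ∏ i, A.particleDensity θ ζ t (ζ t i) :=
    Finset.prod_congr rfl fun t _ => Equiv.prod_comp (Equiv.swap 0 (k t))
      fun i => A.particleDensity θ ζ t (ζ t i)
  have hs0 (t : Fin (n + 1)) : swapPaths k ζ t 0 = ζ t (k t) := by simp [relabel]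
  have hsk (t : Fin (n + 1)) : swapPaths k ζ t (k t) = ζ t 0 := by simp [relabel]
  simp only [particleDensity_relabel, weightSum_relabel, hE, select_swapPaths, swapPaths_zero,
    hsk] at h2
  simp only [hs0] at h2
  rw [mul_comm (∏ t, A.particleDensity θ ζ t (ζ t (k t))),
    mul_comm (S.jointDensity y θ (select ζ k) : ℝ≥0∞), ← h1] at h2
  have hz : S.jointDensity y θ (select ζ fun _ => 0) ≠ 0 := h0
  -- The forward densities of the two paths cancel because they are positive and finite.
  refine (ENNReal.mul_left_inj (mul_ne_zero ?_ ?_) (ENNReal.mul_ne_top ?_ ?_)).1 h2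
  · exact Finset.prod_ne_zero_iff.2 fun t _ => A.particleDensity_ne_zero hz t
  · exact Finset.prod_ne_zero_iff.2 fun t _ => A.particleDensity_ne_zero hk t
  · exact ENNReal.prod_ne_top fun t _ => A.particleDensity_ne_top θ ζ t _
  · exact ENNReal.prod_ne_top fun t _ => A.particleDensity_ne_top θ ζ t _

end ParticleProposal

end Model

/-! ### The algebra of selection and acceptance -/

section Acceptance

theorem div_mul_min_one {s : ℝ≥0∞} (a : ℝ≥0∞) (h0 : s ≠ 0) (ht : s ≠ ∞) :
    a / s * min 1 s = a * min 1 (1 / s) := by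
  rw [div_eq_mul_inv, mul_assoc, one_div]
  congr 1
  rcases le_total s 1 with h | h
  · rw [min_eq_right h, min_eq_left (ENNReal.one_le_inv.2 h), ENNReal.inv_mul_cancel h0 ht]
  · rw [min_eq_left h, min_eq_right (ENNReal.inv_le_one.2 h), mul_one]

/-- Sampling proportionally to `φ r` and accepting with probability `min 1 (∑ φ r)` amounts to
sampling from `φ` and accepting with probability `min 1 (1 / ∑ φ r)`, up to the factor `r`. -/
theorem catProb_mul_min_one {ι : Type*} [Fintype ι] {φ : ι → ℝ≥0∞} (hφ : ∀ l, φ l ≠ ∞)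
    (u m : ℝ≥0) (v m' : ι → ℝ≥0) (hv : ∀ l, v l ≠ 0 → m' l ≠ 0) {r : ι → ℝ≥0∞}
    (hr : ∀ l, r l = (v l * m : ℝ≥0) / (m' l * u : ℝ≥0)) (k : ι) :
    u * (catProb (fun l => φ l * r l) k * min 1 (∑ l, φ l * r l)) =
      m * φ k * ((v k / m' k : ℝ≥0∞) * min 1 (1 / ∑ l, φ l * r l)) := by
  -- If `u = 0` and the right side were nonzero, then `r k = ∞`, so the sum is `∞` and the factor
  -- `min 1 (1 / ∞)` is zero, a contradiction.
  rcases eq_or_ne u 0 with rfl | hu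
  · rw [ENNReal.coe_zero, zero_mul]
    by_contra hne
    obtain ⟨⟨hm, hk⟩, ⟨hvk, -⟩, hmin⟩ : ((m : ℝ≥0∞) ≠ 0 ∧ φ k ≠ 0) ∧
        ((v k : ℝ≥0∞) ≠ 0 ∧ (m' k : ℝ≥0∞) ≠ ∞) ∧ min 1 (1 / ∑ l, φ l * r l) ≠ 0 := by
      simpa only [mul_ne_zero_iff, ENNReal.div_ne_zero] using Ne.symm hne
    have hrk : r k = ∞ := by
      rw [hr, mul_zero, ENNReal.coe_zero, ENNReal.div_zero]
      rw [ENNReal.coe_mul]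
      exact mul_ne_zero hvk hm
    have hs : ∑ l, φ l * r l = ∞ :=
      ENNReal.sum_eq_top.2 ⟨k, Finset.mem_univ k, by rw [hrk, ENNReal.mul_top hk]⟩
    simp [hs] at hmin
  -- The support condition `hv` excludes a nonzero numerator over a zero denominator.
  · have hrt (l : ι) : r l ≠ ∞ := by
      rw [hr]
      rcases eq_or_ne (v l) 0 with h | h
      · simp [h]
      · exact ENNReal.div_ne_top ENNReal.coe_ne_top
          (ENNReal.coe_ne_zero.2 (mul_ne_zero (hv l h) hu))
    have hst : ∑ l, φ l * r l ≠ ∞ :=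
      ENNReal.sum_ne_top.2 fun l _ => ENNReal.mul_ne_top (hφ l) (hrt l)
    have hkey : u * (φ k * r k) = m * φ k * (v k / m' k : ℝ≥0∞) := by
      rw [hr]
      rcases eq_or_ne (v k) 0 with h | h
      · simp [h]
      · have hu' : (u : ℝ≥0∞) ≠ 0 := ENNReal.coe_ne_zero.2 hu
        rw [ENNReal.coe_mul, ENNReal.coe_mul, div_eq_mul_inv, div_eq_mul_inv,
          ENNReal.mul_inv (Or.inr ENNReal.coe_ne_top) (Or.inr hu')]
        calc _ = m * φ k * (v k * (m' k : ℝ≥0∞)⁻¹) * (u * (u : ℝ≥0∞)⁻¹) := by ring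
          _ = _ := by rw [ENNReal.mul_inv_cancel hu' ENNReal.coe_ne_top, mul_one]
    rw [← mul_assoc (m * φ k : ℝ≥0∞), ← hkey]
    -- When all weights are zero, `catProb` is uniform, but the acceptance probability on the left
    -- and `φ k * r k` on the right are both zero.
    rcases eq_or_ne (∑ l, φ l * r l) 0 with hs | hs
    · rw [Finset.sum_eq_zero_iff.1 hs k (Finset.mem_univ k), hs]
      simp
    · rw [catProb_of_ne hs hst, div_mul_min_one _ hs hst, ← mul_assoc]

end Acceptance

/-! ### Balance of the two moves at fixed parameters -/

section Model

variable {Θ Z Y : Type*} [MeasurableSpace Θ] [MeasurableSpace Z]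
  {ν : Measure Θ} {lam : Measure Z} {S : StateSpaceModel Θ Z Y ν lam} {y : ℕ → Y}

namespace ParticleProposal

variable (A : ParticleProposal S y) (Q : ParameterProposal Θ ν) {n M : ℕ}

/-- The weights with which the first selection step draws `𝐤`. -/
abbrev pathWeight (z : Path Z n) (ζ : Particles Z n M) (θ θ' θt : Θ) (l : Fin (n + 1) → Fin M) :
    ℝ≥0∞ :=
  A.backwardProb θt ζ l * S.pathRatio y Q z (select ζ l) θ θ' θt

/-- The density of the current state and of the proposed parameter. -/
def proposalDensity (S : StateSpaceModel Θ Z Y ν lam) (y : ℕ → Y) (Q : ParameterProposal Θ ν)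
    (θ θ' : Θ) (z : Path Z n) : ℝ≥0 :=
  Q.q θ θ' * S.η θ * S.jointDensity y θ z

/-- An instance of `catProb_mul_min_one`: `u` and `v` are the densities of the forward and reverse
proposals, `m` and `m'` the values of `p_θ̃` at the current and selected paths, and the path ratio
is `v m / (m' u)`. -/
theorem proposalDensity_mul_catProb [NeZero M] (z : Path Z n) (ζ : Particles Z n M) (θ θ' θt : Θ)
    (hsupp : ∀ z' : Path Z n, proposalDensity S y Q θ' θ z' ≠ 0 → S.jointDensity y θt z' ≠ 0)
    (k : Fin (n + 1) → Fin M) :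
    proposalDensity S y Q θ θ' z * (catProb (A.pathWeight Q z ζ θ θ' θt) k *
        min 1 (A.allPathsRatio Q z ζ θ θ' θt)) =
      S.jointDensity y θt z * A.backwardProb θt ζ k *
        ((proposalDensity S y Q θ' θ (select ζ k) / S.jointDensity y θt (select ζ k) : ℝ≥0∞) *
          min 1 (1 / A.allPathsRatio Q z ζ θ θ' θt)) := by
  refine catProb_mul_min_one (φ := A.backwardProb θt ζ)
    (r := fun l => S.pathRatio y Q z (select ζ l) θ θ' θt)
    (fun l => ((A.backwardProb_le_one θt ζ l).trans_lt ENNReal.one_lt_top).ne)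
    (proposalDensity S y Q θ θ' z) (S.jointDensity y θt z)
    (fun l => proposalDensity S y Q θ' θ (select ζ l))
    (fun l => S.jointDensity y θt (select ζ l)) (fun l => hsupp _) (fun l => ?_) k
  simp only [StateSpaceModel.pathRatio, proposalDensity]
  congr 2
  ring

theorem measurable_jointDensity_zero [NeZero M] (θ : Θ) :
    Measurable fun ζ : Particles Z n M => S.jointDensity y θ fun t => ζ t 0 :=
  ((S.measurable_jointDensity y).comp (show Measurable fun ζ : Particles Z n M =>
    ((θ, fun t => ζ t 0) : Θ × Path Z n) by fun_prop) :)

theorem measurable_backwardJoint [NeZero M] (θ : Θ) (k : Fin (n + 1) → Fin M) :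
    Measurable fun ζ => A.backwardJoint (n := n) θ ζ k :=
  ((measurable_jointDensity_zero θ).coe_nnreal_ennreal.mul (A.measurable_csmcDensity θ)).mul
    (A.measurable_backwardProb measurable_const measurable_id k)

/-- Change of variables: the swap preserves both the reference measure and `backwardJoint`. -/
theorem lintegral_backwardJoint_swapPaths [SigmaFinite lam] [NeZero M] (θ : Θ)
    (k : Fin (n + 1) → Fin M) {G : Particles Z n M → ℝ≥0∞} (hG : Measurable G) :
    ∫⁻ ζ, A.backwardJoint θ ζ k * G (swapPaths k ζ) ∂Measure.pi (fun _ => Measure.pi fun _ => lam) =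
      ∫⁻ ζ, A.backwardJoint θ ζ k * G ζ ∂Measure.pi (fun _ => Measure.pi fun _ => lam) := by
  rw [← (measurePreserving_relabel lam fun t => Equiv.swap 0 (k t)).lintegral_comp
    (f := fun ζ => A.backwardJoint θ ζ k * G ζ) ((A.measurable_backwardJoint θ k).mul hG)]
  exact lintegral_congr fun ζ => by rw [A.backwardJoint_swapPaths]

section Measurability

variable {α : Type*} [MeasurableSpace α] {z : α → Path Z n} {ζ : α → Particles Z n M}
  {θ θ' θt : α → Θ} {b : α → ℝ≥0∞} {c : (Fin (n + 1) → Fin M) → α → ℝ≥0∞}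

theorem measurable_proposalDensity (hθ : Measurable θ) (hθ' : Measurable θ') (hz : Measurable z) :
    Measurable fun a => proposalDensity S y Q (θ a) (θ' a) (z a) :=
  ((Q.measurable_q.comp (hθ.prodMk hθ')).mul (S.measurable_η.comp hθ)).mul
    ((S.measurable_jointDensity y).comp (hθ.prodMk hz))

theorem measurable_firstIntegrand (hz : Measurable z) (hζ : Measurable ζ) (hθ : Measurable θ)
    (hθ' : Measurable θ') (hθt : Measurable θt) (hb : Measurable b) (hc : ∀ k, Measurable (c k)) :
    Measurable fun a => proposalDensity S y Q (θ a) (θ' a) (z a) * b a *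
      ∑ k, catProb (A.pathWeight Q (z a) (ζ a) (θ a) (θ' a) (θt a)) k *
        (min 1 (A.allPathsRatio Q (z a) (ζ a) (θ a) (θ' a) (θt a)) * c k a) := by
  refine ((measurable_proposalDensity Q hθ hθ' hz).coe_nnreal_ennreal.mul hb).mul
    (Finset.measurable_fun_sum _ fun k _ => (measurable_catProb (fun l => ?_) k).mul
      ((measurable_const.min (A.measurable_allPathsRatio Q hz hζ hθ hθ' hθt)).mul (hc k)))
  exact (A.measurable_backwardProb hθt hζ l).mul
    (S.measurable_pathRatio y Q hz ((measurable_select l).comp hζ) hθ hθ' hθt)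

theorem measurable_secondIntegrand (hz : Measurable z) (hζ : Measurable ζ) (hθ : Measurable θ)
    (hθ' : Measurable θ') (hθt : Measurable θt) (hb : Measurable b) (hc : ∀ k, Measurable (c k)) :
    Measurable fun a => proposalDensity S y Q (θ a) (θ' a) (z a) * b a *
      ∑ k, A.backwardProb (θt a) (ζ a) k *
        (min 1 (1 / A.allPathsRatio Q (select (ζ a) k) (ζ a) (θ' a) (θ a) (θt a)) * c k a) :=
  ((measurable_proposalDensity Q hθ hθ' hz).coe_nnreal_ennreal.mul hb).mul
    (Finset.measurable_fun_sum _ fun k _ => (A.measurable_backwardProb hθt hζ k).mul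
      ((measurable_const.min (measurable_const.div (A.measurable_allPathsRatio Q
        ((measurable_select k).comp hζ) hζ hθ' hθ hθt))).mul (hc k)))

end Measurability

variable (θ θ' θt : Θ)

/-- The contribution of the pair `(ζ_0, ζ^(𝐤))` to the accepted moves. -/
def acceptedFlow [NeZero M] (b c : Path Z n → ℝ≥0∞) (k : Fin (n + 1) → Fin M)
    (ζ : Particles Z n M) : ℝ≥0∞ :=
  (proposalDensity S y Q θ' θ (select ζ k) / S.jointDensity y θt (select ζ k) : ℝ≥0∞) *
    min 1 (1 / A.allPathsRatio Q (fun t => ζ t 0) ζ θ θ' θt) * (b (fun t => ζ t 0) * c (select ζ k))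

theorem measurable_acceptedFlow [NeZero M] {b c : Path Z n → ℝ≥0∞} (hb : Measurable b)
    (hc : Measurable c) (k : Fin (n + 1) → Fin M) :
    Measurable (A.acceptedFlow Q θ θ' θt b c k) := by
  have hz : Measurable fun ζ : Particles Z n M => ((fun t => ζ t 0) : Path Z n) := by fun_prop
  have hk : Measurable fun ζ : Particles Z n M => select ζ k := measurable_select k
  refine ((Measurable.div ?_ ?_).mul (measurable_const.min (measurable_const.div
    (A.measurable_allPathsRatio Q hz measurable_id measurable_const measurable_const
      measurable_const)))).mul ((hb.comp hz).mul (hc.comp hk))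
  · exact (measurable_proposalDensity Q measurable_const measurable_const hk).coe_nnreal_ennreal
  · exact ((S.measurable_jointDensity y).comp (measurable_const.prodMk hk)).coe_nnreal_ennreal

variable [SigmaFinite lam] [NeZero M]

/-- The factor `p_θ̃(z)` released by `proposalDensity_mul_catProb` completes the particle density
and the backward probability to `backwardJoint`. -/
theorem lintegral_firstIntegrand
    (hsupp : ∀ z : Path Z n, proposalDensity S y Q θ' θ z ≠ 0 → S.jointDensity y θt z ≠ 0)
    {b c : Path Z n → ℝ≥0∞} (hb : Measurable b) (hc : Measurable c) :
    ∫⁻ z, ∫⁻ ζ, proposalDensity S y Q θ θ' z * b z *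
        ∑ k, catProb (A.pathWeight Q z ζ θ θ' θt) k *
          (min 1 (A.allPathsRatio Q z ζ θ θ' θt) * c (select ζ k))
        ∂A.csmc M n (θt, z) ∂Measure.pi (fun _ => lam) =
      ∑ k, ∫⁻ ζ : Particles Z n M, A.backwardJoint θt ζ k * A.acceptedFlow Q θ θ' θt b c k ζ
        ∂Measure.pi (fun _ => Measure.pi fun _ => lam) := by
  have hm (k : Fin (n + 1) → Fin M) : Measurable fun ζ : Particles Z n M =>
      A.backwardJoint θt ζ k * A.acceptedFlow Q θ θ' θt b c k ζ :=
    (A.measurable_backwardJoint θt k).mul (A.measurable_acceptedFlow Q θ θ' θt hb hc k)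
  rw [A.lintegral_csmc M n θt (F := fun z ζ => proposalDensity S y Q θ θ' z * b z *
    ∑ k, catProb (A.pathWeight Q z ζ θ θ' θt) k *
      (min 1 (A.allPathsRatio Q z ζ θ θ' θt) * c (select ζ k)))
    (A.measurable_firstIntegrand Q measurable_fst measurable_snd measurable_const
      measurable_const measurable_const (hb.comp measurable_fst)
      fun k => hc.comp ((measurable_select k).comp measurable_snd)), ← lintegral_finsetSum _ fun k _ => hm k]
  refine lintegral_congr fun ζ => ?_
  rw [Finset.mul_sum, Finset.mul_sum]
  refine Finset.sum_congr rfl fun k _ => ?_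
  have h := A.proposalDensity_mul_catProb Q (fun t => ζ t 0) ζ θ θ' θt hsupp k
  calc _ = proposalDensity S y Q θ θ' (fun t => ζ t 0) *
          (catProb (A.pathWeight Q (fun t => ζ t 0) ζ θ θ' θt) k *
            min 1 (A.allPathsRatio Q (fun t => ζ t 0) ζ θ θ' θt)) *
          (A.csmcDensity θt ζ * (b (fun t => ζ t 0) * c (select ζ k))) := by ring
    _ = _ := by rw [h, backwardJoint, acceptedFlow]; ring

/-- Here `𝐤` is already drawn from `φ`, and only the factor `p_θ̃` at the retained path is missing.
This path plays the role of the selected path of the first move, whence `swapPaths`. -/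
theorem lintegral_secondIntegrand
    (hsupp : ∀ z : Path Z n, proposalDensity S y Q θ' θ z ≠ 0 → S.jointDensity y θt z ≠ 0)
    {b c : Path Z n → ℝ≥0∞} (hb : Measurable b) (hc : Measurable c) :
    ∫⁻ z, ∫⁻ ζ, proposalDensity S y Q θ' θ z * c z *
        ∑ k, A.backwardProb θt ζ k *
          (min 1 (1 / A.allPathsRatio Q (select ζ k) ζ θ θ' θt) * b (select ζ k))
        ∂A.csmc M n (θt, z) ∂Measure.pi (fun _ => lam) =
      ∑ k, ∫⁻ ζ : Particles Z n M,
        A.backwardJoint θt ζ k * A.acceptedFlow Q θ θ' θt b c k (swapPaths k ζ)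
        ∂Measure.pi (fun _ => Measure.pi fun _ => lam) := by
  have hm (k : Fin (n + 1) → Fin M) : Measurable fun ζ : Particles Z n M =>
      A.backwardJoint θt ζ k * A.acceptedFlow Q θ θ' θt b c k (swapPaths k ζ) :=
    (A.measurable_backwardJoint θt k).mul ((A.measurable_acceptedFlow Q θ θ' θt hb hc k).comp
      (measurePreserving_relabel lam fun t => Equiv.swap 0 (k t)).measurable)
  rw [A.lintegral_csmc M n θt (F := fun z ζ => proposalDensity S y Q θ' θ z * c z *
    ∑ k, A.backwardProb θt ζ k *
      (min 1 (1 / A.allPathsRatio Q (select ζ k) ζ θ θ' θt) * b (select ζ k)))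
    (A.measurable_secondIntegrand Q measurable_fst measurable_snd measurable_const
      measurable_const measurable_const (hc.comp measurable_fst)
      fun k => hb.comp ((measurable_select k).comp measurable_snd)), ← lintegral_finsetSum _ fun k _ => hm k]
  refine lintegral_congr fun ζ => ?_
  rw [Finset.mul_sum, Finset.mul_sum]
  refine Finset.sum_congr rfl fun k _ => ?_
  rw [acceptedFlow, select_swapPaths, swapPaths_zero, A.allPathsRatio_relabel, backwardJoint]
  -- Multiplying and dividing by `p_θ̃` is legitimate where it vanishes, because `hsupp` makes the
  -- numerator vanish there too.
  have h : (proposalDensity S y Q θ' θ (fun t => ζ t 0) : ℝ≥0∞) =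
      S.jointDensity y θt (fun t => ζ t 0) *
        (proposalDensity S y Q θ' θ (fun t => ζ t 0) / S.jointDensity y θt fun t => ζ t 0) := by
    refine (ENNReal.mul_div_cancel' (fun h0 => ?_) fun h => absurd h ENNReal.coe_ne_top).symm
    by_contra hne
    exact hsupp _ (ENNReal.coe_ne_zero.1 hne) (ENNReal.coe_eq_zero.1 h0)
  have alg {d c₀ p a m b₀ e : ℝ≥0∞} (h : p = m * (p / m)) :
      d * (p * c₀ * (a * (e * b₀))) = m * d * a * (p / m * e * (b₀ * c₀)) := by
    calc _ = p * (d * c₀ * (a * (e * b₀))) := by ring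
      _ = m * (p / m) * (d * c₀ * (a * (e * b₀))) := by rw [← h]
      _ = _ := by ring
  exact alg h

/-- At fixed parameters, the accepted first moves from `b` to `c` balance the accepted second
moves from `c` to `b`. -/
theorem lintegral_firstIntegrand_eq_secondIntegrand
    (hsupp : ∀ z : Path Z n, proposalDensity S y Q θ' θ z ≠ 0 → S.jointDensity y θt z ≠ 0)
    {b c : Path Z n → ℝ≥0∞} (hb : Measurable b) (hc : Measurable c) :
    ∫⁻ z, ∫⁻ ζ, proposalDensity S y Q θ θ' z * b z *
        ∑ k, catProb (A.pathWeight Q z ζ θ θ' θt) k *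
          (min 1 (A.allPathsRatio Q z ζ θ θ' θt) * c (select ζ k))
        ∂A.csmc M n (θt, z) ∂Measure.pi (fun _ => lam) =
      ∫⁻ z, ∫⁻ ζ, proposalDensity S y Q θ' θ z * c z *
        ∑ k, A.backwardProb θt ζ k *
          (min 1 (1 / A.allPathsRatio Q (select ζ k) ζ θ θ' θt) * b (select ζ k))
        ∂A.csmc M n (θt, z) ∂Measure.pi (fun _ => lam) := by
  rw [A.lintegral_firstIntegrand Q θ θ' θt hsupp hb hc,
    A.lintegral_secondIntegrand Q θ θ' θt hsupp hb hc]
  exact Finset.sum_congr rfl fun k _ => (A.lintegral_backwardJoint_swapPaths θt k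
    (A.measurable_acceptedFlow Q θ θ' θt hb hc k)).symm

end ParticleProposal

end Model

/-! ### Integration over the parameters and detailed balance -/

section Model

variable {Θ Z Y : Type*} [MeasurableSpace Θ] [MeasurableSpace Z]
  {ν : Measure Θ} {lam : Measure Z} {S : StateSpaceModel Θ Z Y ν lam} {y : ℕ → Y}

namespace ParticleProposal

variable (A : ParticleProposal S y) (Q : ParameterProposal Θ ν)
  (I : IntermediateParameter Θ) (M n : ℕ)

theorem selectSecond_apply (a : (Θ × Path Z n) × Θ × Particles Z n M) {C : Set (Θ × Path Z n)}
    (hC : MeasurableSet C) :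
    A.selectSecond Q I M n a C =
      (∑ k, A.backwardProb (I.snd a.1.1 a.2.1) a.2.2 k *
        (min 1 (1 / A.allPathsRatio Q (select a.2.2 k) a.2.2 a.2.1 a.1.1 (I.snd a.1.1 a.2.1)) *
          C.indicator 1 (a.2.1, select a.2.2 k))) +
      (∑ k, A.backwardProb (I.snd a.1.1 a.2.1) a.2.2 k *
        (1 - min 1 (1 / A.allPathsRatio Q (select a.2.2 k) a.2.2 a.2.1 a.1.1
          (I.snd a.1.1 a.2.1)))) * C.indicator 1 a.1 := by
  have h : A.selectSecond Q I M n a C =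
      ∑ k, A.backwardProb (I.snd a.1.1 a.2.1) a.2.2 k *
        (min 1 (1 / A.allPathsRatio Q (select a.2.2 k) a.2.2 a.2.1 a.1.1 (I.snd a.1.1 a.2.1)) *
          Measure.dirac (a.2.1, select a.2.2 k) C +
        (1 - min 1 (1 / A.allPathsRatio Q (select a.2.2 k) a.2.2 a.2.1 a.1.1
          (I.snd a.1.1 a.2.1))) * Measure.dirac a.1 C) := by
    change (∑ k, _ • _ : Measure (Θ × Path Z n)) C = _
    rw [Measure.coe_finsetSum, Finset.sum_apply]
    rfl
  simp only [h, Measure.dirac_apply' _ hC, mul_add, Finset.sum_add_distrib, Finset.sum_mul,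
    mul_assoc]

variable [NeZero M]

/-- The acceptance probability does not depend on `𝐤`, so the selection probabilities sum out of the
rejection term, unlike in the second move. -/
theorem selectFirst_apply (a : (Θ × Path Z n) × Θ × Particles Z n M) {C : Set (Θ × Path Z n)}
    (hC : MeasurableSet C) :
    A.selectFirst Q I M n a C =
      (∑ k, catProb (A.pathWeight Q a.1.2 a.2.2 a.1.1 a.2.1 (I.fst a.1.1 a.2.1)) k *
        (min 1 (A.allPathsRatio Q a.1.2 a.2.2 a.1.1 a.2.1 (I.fst a.1.1 a.2.1)) *
          C.indicator 1 (a.2.1, select a.2.2 k))) +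
      (1 - min 1 (A.allPathsRatio Q a.1.2 a.2.2 a.1.1 a.2.1 (I.fst a.1.1 a.2.1))) *
        C.indicator 1 a.1 := by
  have h : A.selectFirst Q I M n a C =
      ∑ k, catProb (A.pathWeight Q a.1.2 a.2.2 a.1.1 a.2.1 (I.fst a.1.1 a.2.1)) k *
        (min 1 (A.allPathsRatio Q a.1.2 a.2.2 a.1.1 a.2.1 (I.fst a.1.1 a.2.1)) *
          Measure.dirac (a.2.1, select a.2.2 k) C +
        (1 - min 1 (A.allPathsRatio Q a.1.2 a.2.2 a.1.1 a.2.1 (I.fst a.1.1 a.2.1))) *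
          Measure.dirac a.1 C) := by
    change (∑ k, _ • _ : Measure (Θ × Path Z n)) C = _
    rw [Measure.coe_finsetSum, Finset.sum_apply]
    rfl
  simp only [h, Measure.dirac_apply' _ hC, mul_add, Finset.sum_add_distrib, ← Finset.sum_mul,
    sum_catProb, one_mul]

variable [SigmaFinite lam]

/-- The integral of `F` against the joint law of the current state, the proposed parameter and the
particles, when the density of the current state is left to `F`. -/
def extendedIntegral (c : Θ → Θ → Θ) (F : (Θ × Path Z n) × Θ × Particles Z n M → ℝ≥0∞) : ℝ≥0∞ :=
  ∫⁻ θ, ∫⁻ θ', ∫⁻ z, ∫⁻ ζ, F ((θ, z), θ', ζ) ∂A.csmc M n (c θ θ', z)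
    ∂Measure.pi (fun _ => lam) ∂ν ∂ν

theorem measurable_lintegral_csmc_comp {c : Θ → Θ → Θ} (hc : Measurable (Function.uncurry c))
    {F : (Θ × Path Z n) × Θ × Particles Z n M → ℝ≥0∞} (hF : Measurable F) :
    Measurable fun p : (Θ × Θ) × Path Z n =>
      ∫⁻ ζ, F ((p.1.1, p.2), p.1.2, ζ) ∂A.csmc M n (c p.1.1 p.1.2, p.2) := by
  have : IsMarkovKernel ((A.csmc M n).comap (fun p : (Θ × Θ) × Path Z n =>
      (c p.1.1 p.1.2, p.2)) ((hc.comp measurable_fst).prodMk measurable_snd)) :=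
    Kernel.IsMarkovKernel.comap _ _
  have h := Measurable.lintegral_kernel_prod_right'
    (κ := (A.csmc M n).comap (fun p : (Θ × Θ) × Path Z n => (c p.1.1 p.1.2, p.2))
      ((hc.comp measurable_fst).prodMk measurable_snd))
    (hF.comp (show Measurable fun q : ((Θ × Θ) × Path Z n) × Particles Z n M =>
      ((q.1.1.1, q.1.2), q.1.1.2, q.2) by fun_prop))
  exact h

variable [SigmaFinite ν]

theorem extendedIntegral_add {c : Θ → Θ → Θ} (hc : Measurable (Function.uncurry c))
    {F G : (Θ × Path Z n) × Θ × Particles Z n M → ℝ≥0∞} (hF : Measurable F) :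
    A.extendedIntegral M n c (fun a => F a + G a) =
      A.extendedIntegral M n c F + A.extendedIntegral M n c G := by
  have h1 := A.measurable_lintegral_csmc_comp M n hc hF
  have h2 := h1.lintegral_prod_right' (ν := Measure.pi (fun _ => lam))
  unfold extendedIntegral
  refine (lintegral_congr fun θ => ?_).trans (lintegral_add_left h2.lintegral_prod_right' _)
  refine (lintegral_congr fun θ' => ?_).trans
    (lintegral_add_left (h2.comp (measurable_prodMk_left (x := θ))) _)
  refine (lintegral_congr fun z => ?_).trans
    (lintegral_add_left (h1.comp (measurable_prodMk_left (x := (θ, θ')))) _)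
  exact lintegral_add_left (hF.comp (show Measurable fun ζ : Particles Z n M => ((θ, z), θ', ζ) by
    fun_prop)) _

/-- The mass which a move sends from `B` to `C`. -/
theorem setLIntegral_move {c : Θ → Θ → Θ} (hc : Measurable (Function.uncurry c))
    (sel : Kernel ((Θ × Path Z n) × Θ × Particles Z n M) (Θ × Path Z n)) [IsMarkovKernel sel]
    {B C : Set (Θ × Path Z n)} (hB : MeasurableSet B) (hC : MeasurableSet C) :
    ∫⁻ x in B, A.move Q M n c hc sel x C ∂S.unnormalisedPosterior y n =
      A.extendedIntegral M n c fun a =>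
        proposalDensity S y Q a.1.1 a.2.1 a.1.2 * B.indicator 1 a.1 * sel a C := by
  have hs : Measurable fun a => sel a C := Kernel.measurable_coe sel hC
  have hI := A.measurable_lintegral_csmc_comp M n hc hs
  have hmove (x : Θ × Path Z n) : A.move Q M n c hc sel x C =
      ∫⁻ θ', Q.q x.1 θ' * ∫⁻ ζ, sel (x, θ', ζ) C ∂A.csmc M n (c x.1 θ', x.2) ∂ν := by
    have : IsMarkovKernel ((A.csmc M n).comap
        (fun b : (Θ × Path Z n) × Θ => (c b.1.1 b.2, b.1.2))
        ((hc.comp (measurable_fst.fst.prodMk measurable_snd)).prodMk measurable_fst.snd)) :=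
      Kernel.IsMarkovKernel.comap _ _
    have hq : Measurable (Function.uncurry fun (x : Θ × Path Z n) θ' => Q.q x.1 θ') :=
      Q.measurable_q.comp ((measurable_fst.comp measurable_fst).prodMk measurable_snd)
    rw [move, Kernel.snd_apply' _ _ hC, Kernel.compProd_apply (measurable_snd hC)]
    have hsx : Measurable fun b : Θ × Particles Z n M => sel (x, b) C :=
      hs.comp measurable_prodMk_left
    refine (Kernel.lintegral_compProd _ _ _ hsx).trans ?_
    have hIx : Measurable fun θ' : Θ => ∫⁻ ζ, sel (x, θ', ζ) C ∂A.csmc M n (c x.1 θ', x.2) :=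
      (hI.comp (show Measurable fun θ' : Θ => ((x.1, θ'), x.2) by fun_prop) :)
    change ∫⁻ θ', ∫⁻ ζ, sel (x, θ', ζ) C ∂A.csmc M n (c x.1 θ', x.2) ∂proposeParameter Q n x = _
    have hqx : Measurable fun θ' => (Q.q x.1 θ' : ℝ≥0∞) :=
      (Q.measurable_q.comp measurable_prodMk_left).coe_nnreal_ennreal
    rw [proposeParameter, densityKernel_apply ν hq,
      lintegral_withDensity_eq_lintegral_mul _ hqx hIx]
    rfl
  have hd : Measurable fun x : Θ × Path Z n => S.η x.1 * S.jointDensity y x.1 x.2 :=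
    (S.measurable_η.comp measurable_fst).mul (S.measurable_jointDensity y)
  have hm : Measurable fun x : Θ × Path Z n => A.move Q M n c hc sel x C :=
    Kernel.measurable_coe _ hC
  have hBi : Measurable (B.indicator (1 : Θ × Path Z n → ℝ≥0∞)) := measurable_one.indicator hB
  have hJ : Measurable fun x : Θ × Path Z n => (S.η x.1 * S.jointDensity y x.1 x.2 : ℝ≥0) *
      (B.indicator 1 x * A.move Q M n c hc sel x C) := hd.coe_nnreal_ennreal.mul (hBi.mul hm)
  have hK : Measurable fun p : (Θ × Θ) × Path Z n =>
      (proposalDensity S y Q p.1.1 p.1.2 p.2 * B.indicator 1 (p.1.1, p.2) : ℝ≥0∞) *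
        ∫⁻ ζ, sel ((p.1.1, p.2), p.1.2, ζ) C ∂A.csmc M n (c p.1.1 p.1.2, p.2) := by
    have hx : Measurable fun p : (Θ × Θ) × Path Z n => (p.1.1, p.2) := by fun_prop
    refine (Measurable.mul (Measurable.coe_nnreal_ennreal ?_) (hBi.comp hx)).mul hI
    exact ((Q.measurable_q.comp measurable_fst).mul (S.measurable_η.comp measurable_fst.fst)).mul
      ((S.measurable_jointDensity y).comp hx)
  have hstep : ∫⁻ x in B, A.move Q M n c hc sel x C ∂S.unnormalisedPosterior y n =
      ∫⁻ x, (S.η x.1 * S.jointDensity y x.1 x.2 : ℝ≥0) *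
        (B.indicator 1 x * A.move Q M n c hc sel x C)
        ∂ν.prod (Measure.pi fun _ : Fin (n + 1) => lam) := by
    rw [← lintegral_indicator hB, StateSpaceModel.unnormalisedPosterior,
      lintegral_withDensity_eq_lintegral_mul _ hd.coe_nnreal_ennreal (hm.indicator hB)]
    refine lintegral_congr fun x => ?_
    by_cases hx : x ∈ B <;> simp [hx]
  rw [hstep, lintegral_prod _ hJ.aemeasurable]
  refine lintegral_congr fun θ => ?_
  have hKθ : Measurable fun p : Path Z n × Θ =>
      (proposalDensity S y Q θ p.2 p.1 * B.indicator 1 (θ, p.1) : ℝ≥0∞) *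
        ∫⁻ ζ, sel ((θ, p.1), p.2, ζ) C ∂A.csmc M n (c θ p.2, p.1) :=
    (hK.comp (show Measurable fun p : Path Z n × Θ => ((θ, p.2), p.1) by fun_prop) :)
  -- Both parameters are moved outside the path integral, so that balance can be checked with them
  -- fixed.
  have hsw := lintegral_lintegral_swap (μ := Measure.pi fun _ : Fin (n + 1) => lam) (ν := ν)
    (f := fun z θ' => (proposalDensity S y Q θ θ' z * B.indicator 1 (θ, z) : ℝ≥0∞) *
      ∫⁻ ζ, sel ((θ, z), θ', ζ) C ∂A.csmc M n (c θ θ', z)) hKθ.aemeasurable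
  refine Eq.trans (lintegral_congr fun z => ?_) (hsw.trans (lintegral_congr fun θ' =>
    lintegral_congr fun z => (lintegral_const_mul _ (hs.comp (show Measurable fun
      ζ : Particles Z n M => ((θ, z), θ', ζ) by fun_prop))).symm))
  rw [hmove, ← mul_assoc, ← lintegral_const_mul]
  · refine lintegral_congr fun θ' => ?_
    rw [proposalDensity]
    push_cast
    ring
  · exact (Q.measurable_q.comp measurable_prodMk_left).coe_nnreal_ennreal.mul
      (hI.comp (show Measurable fun θ' : Θ => ((θ, θ'), z) by fun_prop))

/-- The accepted first moves from `B` to `C` balance the accepted second moves from `C` to `B`. -/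
theorem extendedIntegral_first_eq_second
    (hsupp : ∀ (θ θ' : Θ) (z : Path Z n), S.η θ ≠ 0 → Q.q θ θ' ≠ 0 →
      S.jointDensity y θ z ≠ 0 → S.jointDensity y (I.snd θ θ') z ≠ 0)
    {B C : Set (Θ × Path Z n)} (hB : MeasurableSet B) (hC : MeasurableSet C) :
    A.extendedIntegral M n I.fst (fun a =>
        proposalDensity S y Q a.1.1 a.2.1 a.1.2 * B.indicator 1 a.1 *
          ∑ k, catProb (A.pathWeight Q a.1.2 a.2.2 a.1.1 a.2.1 (I.fst a.1.1 a.2.1)) k *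
            (min 1 (A.allPathsRatio Q a.1.2 a.2.2 a.1.1 a.2.1 (I.fst a.1.1 a.2.1)) *
              C.indicator 1 (a.2.1, select a.2.2 k))) =
      A.extendedIntegral M n I.snd (fun a =>
        proposalDensity S y Q a.1.1 a.2.1 a.1.2 * C.indicator 1 a.1 *
          ∑ k, A.backwardProb (I.snd a.1.1 a.2.1) a.2.2 k *
            (min 1 (1 / A.allPathsRatio Q (select a.2.2 k) a.2.2 a.2.1 a.1.1
              (I.snd a.1.1 a.2.1)) * B.indicator 1 (a.2.1, select a.2.2 k))) := by
  have hBi : Measurable (B.indicator (1 : Θ × Path Z n → ℝ≥0∞)) := measurable_one.indicator hB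
  have hCi : Measurable (C.indicator (1 : Θ × Path Z n → ℝ≥0∞)) := measurable_one.indicator hC
  have hm := (A.measurable_lintegral_csmc_comp M n I.measurable_snd
    (A.measurable_secondIntegrand Q (M := M) (n := n)
      (α := (Θ × Path Z n) × Θ × Particles Z n M)
      measurable_fst.snd measurable_snd.snd measurable_fst.fst
      measurable_snd.fst (I.measurable_snd.comp (measurable_fst.fst.prodMk measurable_snd.fst))
      (hCi.comp measurable_fst) fun k => hBi.comp (measurable_snd.fst.prodMk
        ((measurable_select k).comp measurable_snd.snd)))).lintegral_prod_right'
    (ν := Measure.pi (fun _ => lam))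
  -- The second move starts from `θ'`, so the two parameters exchange roles on the right.
  refine Eq.trans ?_ (lintegral_lintegral_swap hm.aemeasurable).symm
  refine lintegral_congr fun θ => lintegral_congr fun θ' => ?_
  -- From here on both conditional SMC runs use the same intermediate parameter.
  simp only [I.symm]
  refine A.lintegral_firstIntegrand_eq_secondIntegrand Q θ θ' (I.snd θ' θ) (fun z hz => ?_)
    (b := fun z => B.indicator 1 (θ, z)) (c := fun z => C.indicator 1 (θ', z))
    (hBi.comp measurable_prodMk_left) (hCi.comp measurable_prodMk_left)
  rw [proposalDensity, mul_ne_zero_iff, mul_ne_zero_iff] at hz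
  exact hsupp θ' θ z hz.1.2 hz.1.1 hz.2

/-- The mass which the first move sends from `B` to `C`: accepted moves and rejected ones. -/
theorem setLIntegral_first {B C : Set (Θ × Path Z n)} (hB : MeasurableSet B)
    (hC : MeasurableSet C) :
    ∫⁻ x in B, A.move Q M n I.fst I.measurable_fst (A.selectFirst Q I M n) x C
        ∂S.unnormalisedPosterior y n =
      A.extendedIntegral M n I.fst (fun a =>
        proposalDensity S y Q a.1.1 a.2.1 a.1.2 * B.indicator 1 a.1 *
          ∑ k, catProb (A.pathWeight Q a.1.2 a.2.2 a.1.1 a.2.1 (I.fst a.1.1 a.2.1)) k *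
            (min 1 (A.allPathsRatio Q a.1.2 a.2.2 a.1.1 a.2.1 (I.fst a.1.1 a.2.1)) *
              C.indicator 1 (a.2.1, select a.2.2 k))) +
      A.extendedIntegral M n I.fst (fun a => (B.indicator 1 a.1 * C.indicator 1 a.1) *
        (proposalDensity S y Q a.1.1 a.2.1 a.1.2 *
          (1 - min 1 (A.allPathsRatio Q a.1.2 a.2.2 a.1.1 a.2.1 (I.fst a.1.1 a.2.1))))) := by
  have hBi : Measurable (B.indicator (1 : Θ × Path Z n → ℝ≥0∞)) := measurable_one.indicator hB
  have hCi : Measurable (C.indicator (1 : Θ × Path Z n → ℝ≥0∞)) := measurable_one.indicator hC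
  rw [A.setLIntegral_move Q M n I.measurable_fst _ hB hC]
  refine Eq.trans ?_ (A.extendedIntegral_add M n I.measurable_fst
    (A.measurable_firstIntegrand Q (M := M) (n := n)
      (α := (Θ × Path Z n) × Θ × Particles Z n M)
      measurable_fst.snd measurable_snd.snd measurable_fst.fst
      measurable_snd.fst (I.measurable_fst.comp (measurable_fst.fst.prodMk measurable_snd.fst))
      (hBi.comp measurable_fst) fun k => hCi.comp (measurable_snd.fst.prodMk
        ((measurable_select k).comp measurable_snd.snd))))
  congr 1
  ext a
  rw [A.selectFirst_apply Q I M n a hC]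
  ring

/-- The mass which the second move sends from `B` to `C`: accepted moves and rejected ones. -/
theorem setLIntegral_second {B C : Set (Θ × Path Z n)} (hB : MeasurableSet B)
    (hC : MeasurableSet C) :
    ∫⁻ x in B, A.move Q M n I.snd I.measurable_snd (A.selectSecond Q I M n) x C
        ∂S.unnormalisedPosterior y n =
      A.extendedIntegral M n I.snd (fun a =>
        proposalDensity S y Q a.1.1 a.2.1 a.1.2 * B.indicator 1 a.1 *
          ∑ k, A.backwardProb (I.snd a.1.1 a.2.1) a.2.2 k *
            (min 1 (1 / A.allPathsRatio Q (select a.2.2 k) a.2.2 a.2.1 a.1.1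
              (I.snd a.1.1 a.2.1)) * C.indicator 1 (a.2.1, select a.2.2 k))) +
      A.extendedIntegral M n I.snd (fun a => (B.indicator 1 a.1 * C.indicator 1 a.1) *
        (proposalDensity S y Q a.1.1 a.2.1 a.1.2 *
          ∑ k, A.backwardProb (I.snd a.1.1 a.2.1) a.2.2 k *
            (1 - min 1 (1 / A.allPathsRatio Q (select a.2.2 k) a.2.2 a.2.1 a.1.1
              (I.snd a.1.1 a.2.1))))) := by
  have hBi : Measurable (B.indicator (1 : Θ × Path Z n → ℝ≥0∞)) := measurable_one.indicator hB
  have hCi : Measurable (C.indicator (1 : Θ × Path Z n → ℝ≥0∞)) := measurable_one.indicator hC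
  rw [A.setLIntegral_move Q M n I.measurable_snd _ hB hC]
  refine Eq.trans ?_ (A.extendedIntegral_add M n I.measurable_snd
    (A.measurable_secondIntegrand Q (M := M) (n := n)
      (α := (Θ × Path Z n) × Θ × Particles Z n M)
      measurable_fst.snd measurable_snd.snd measurable_fst.fst
      measurable_snd.fst (I.measurable_snd.comp (measurable_fst.fst.prodMk measurable_snd.fst))
      (hBi.comp measurable_fst) fun k => hCi.comp (measurable_snd.fst.prodMk
        ((measurable_select k).comp measurable_snd.snd))))
  congr 1
  ext a
  rw [A.selectSecond_apply Q I M n a hC]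
  ring

theorem setLIntegral_mhaarKernel {B C : Set (Θ × Path Z n)} (hC : MeasurableSet C)
    (m : Measure (Θ × Path Z n)) :
    ∫⁻ x in B, A.mhaarKernel Q I M n x C ∂m =
      1 / 2 * (∫⁻ x in B, A.move Q M n I.fst I.measurable_fst (A.selectFirst Q I M n) x C ∂m +
        ∫⁻ x in B, A.move Q M n I.snd I.measurable_snd (A.selectSecond Q I M n) x C ∂m) := by
  have h (x : Θ × Path Z n) : A.mhaarKernel Q I M n x C =
      1 / 2 * (A.move Q M n I.fst I.measurable_fst (A.selectFirst Q I M n) x C +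
        A.move Q M n I.snd I.measurable_snd (A.selectSecond Q I M n) x C) := by
    change (∑ k : Fin 2, _ • _ : Measure (Θ × Path Z n)) C = _
    rw [Fin.sum_univ_two, mul_add]
    rfl
  simp_rw [h]
  have h1 := Kernel.measurable_coe
    (A.move Q M n I.fst I.measurable_fst (A.selectFirst Q I M n)) hC
  have h2 := Kernel.measurable_coe
    (A.move Q M n I.snd I.measurable_snd (A.selectSecond Q I M n)) hC
  exact (lintegral_const_mul _ (h1.add h2)).trans (congrArg _ (lintegral_add_left h1 _))

/-- Detailed balance with respect to the unnormalised posterior. -/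
theorem isReversible_unnormalisedPosterior
    (hsupp : ∀ (θ θ' : Θ) (z : Path Z n), S.η θ ≠ 0 → Q.q θ θ' ≠ 0 →
      S.jointDensity y θ z ≠ 0 → S.jointDensity y (I.snd θ θ') z ≠ 0) :
    (A.mhaarKernel Q I M n).IsReversible (S.unnormalisedPosterior y n) := by
  intro B C hB hC
  -- Accepted first moves are rewritten as accepted second moves in the opposite direction, so the
  -- accepted terms of the two sides agree up to order.
  rw [A.setLIntegral_mhaarKernel Q I M n hC, A.setLIntegral_mhaarKernel Q I M n hB,
    A.setLIntegral_first Q I M n hB hC, A.setLIntegral_first Q I M n hC hB,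
    A.setLIntegral_second Q I M n hB hC, A.setLIntegral_second Q I M n hC hB,
    A.extendedIntegral_first_eq_second Q I M n hsupp hB hC,
    A.extendedIntegral_first_eq_second Q I M n hsupp hC hB]
  -- The rejection terms contain `B` and `C` only through the product of their indicators, hence are
  -- symmetric.
  simp only [mul_comm (B.indicator (1 : Θ × Path Z n → ℝ≥0∞) _)]
  ring

end ParticleProposal

end Model

end MHAAR

end

theorem mainTheorem10 {Θ Z Y : Type*} [MeasurableSpace Θ] [MeasurableSpace Z]
    (ν : MeasureTheory.Measure Θ) [MeasureTheory.SigmaFinite ν]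
    (lam : MeasureTheory.Measure Z) [MeasureTheory.SigmaFinite lam]
    (S : MHAAR.StateSpaceModel Θ Z Y ν lam) (y : ℕ → Y)
    (A : MHAAR.ParticleProposal S y) (Q : MHAAR.ParameterProposal Θ ν)
    (I : MHAAR.IntermediateParameter Θ)
    (n M : ℕ) [NeZero M]
    (hsupp : ∀ (θ θ' : Θ) (z : MHAAR.Path Z n), S.η θ ≠ 0 → Q.q θ θ' ≠ 0 →
      S.jointDensity y θ z ≠ 0 → S.jointDensity y (I.snd θ θ') z ≠ 0) :
    (A.mhaarKernel Q I M n).IsReversible (S.posterior y n) := by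
  intro B C hB hC
  have h := A.isReversible_unnormalisedPosterior Q I M n hsupp hB hC
  -- The normalising constant multiplies both sides, so its value is irrelevant, even if it is `0`
  -- or `∞`.
  simp only [MHAAR.StateSpaceModel.posterior, Measure.restrict_smul, lintegral_smul_measure, h]
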